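/- **Setting (non-preemptive machine replenishment).** There are $n$ machines and a repair capacity $M\ge 1$. Machine $i$ has a finite set $S_i$ of active states, a transition matrix $(p_{uv})_{u,v\in S_i}$, rewards $r_u\ge 0$ and repair costs $c_u\ge 0$ $(u\in S_i)$, a repair success probability $s_i\in(0,1]$ and an initial active state $\rho_i\in S_i$. At the beginning of each time slot the scheduler, who sees all states, may move any active machines to the repair queue, paying $c_u$ for a machine in state $u$; then it chooses at most $M$ machines in the repair queue (machines just moved there included) to be worked on in this slot. A machine leaves the queue only when its repair is complete, and a repair that has been started must be worked on in every slot until it is complete. A machine that is worked on completes its repair at the end of the slot with probability $s_i$ and is then in state $\rho_i$ at the beginning of the next slot. An active machine in state $u$ that is not moved yields reward $r_u$ in the slot and moves to $v\in S_i$ with probability $p_{uv}$; machines in the queue yield no reward. All these random events are independent. Let $R_t$ be the expected total reward minus cost in slot $t$, and let $OPT$ be the supremum of $\limsup_T \frac1T\sum_{t<T}R_t$ over all history-dependent, possibly randomized scheduling policies and all active start states. **Balanced programs.** The balanced dual program in the variables $\lambda$, $h_i$, $\phi_u$ is $$\begin{array}{lll}\text{minimize } M\lambda+\sum_i h_i \text{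 subject to}\quad & \lambda+h_i\ge s_i\phi_{\rho_i} & \forall i,\\ & h_i\ge r_u+\sum_{v\in S_i}p_{uv}(\phi_v-\phi_u) & \forall i,\,u\in S_i,\\ & \phi_u+c_u\ge 0 & \forall i,\,u\in S_i,\\ & M\lambda=\sum_i h_i,\quad \lambda,h_i\ge 0 .\end{array}$$ Its linear programming dual, the balanced primal program, in the variables $x_u,z_u,x_{\kappa_i}\ge 0$ and $\omega\in\mathbb R$, is $$\begin{array}{lll}\text{maximize } \sum_i\sum_{u\in S_i}(r_ux_u-c_uz_u) \text{ subject to}\quad & \sum_i x_{\kappa_i}\le M(1+\omega), & \\ & x_{\kappa_i}+\sum_{u\in S_i}x_u\le 1-\omega & \forall i,\\ & [u=\rho_i]\,s_ix_{\kappa_i}+\sum_{v\ne u}x_vp_{vu}=z_u+\sum_{v\neq u}x_up_{uv} & \forall i,\,u\in S_i.\end{array}$$ **Balanced policy.** Given optimal solutions $(\lambda,h,\phi)$ and $(x,x_\kappa,z,\omega)$ of the two programs: at the beginning of each slot, move a machine $i$ to the repair queue exactly when $h_i>0$ and it is in an active state $u$ with $z_u>0$. Then, if $S_r$ is the set of machines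 in the queue, work on some $\min(M,|S_r|)$ of them, non-preemptively and otherwise chosen arbitrarily. **Theorem.** Both balanced programs have optimal solutions. For all optimal solutions of the two, let each machine start in an active state such that every machine $i$ with $h_i>0$ either starts in a state $u$ with $x_u+z_u>0$, or starts in $\rho_i$ and the Markov chain $(p_{uv})_{u,v\in S_i}$ has a single recurrent class. Such start states exist; for any of them balanced policies exist, and every balanced policy is a valid scheduling policy that is a $2$-approximation: $$\liminf_{T\to\infty}\frac1T\sum_{t<T}R_t\ \ge\ \tfrac12\,OPT .$$ -/

import Mathlib

open Finset Filter
open scoped NNReal ENNReal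

universe u

namespace Replenishment

/-- An instance of non-preemptive machine replenishment with `n` machines; `S i` is the set of
active states of machine `i`. -/
structure Model (n : ℕ) (S : Fin n → Type u) where
  /-- `p i u` is the distribution of the next state of an active machine `i` in state `u`. -/
  p : ∀ i, S i → PMF (S i)
  /-- reward per time slot in an active state -/
  r : ∀ i, S i → ℝ
  r_nonneg : ∀ i u, 0 ≤ r i u
  /-- cost of moving the machine from an active state to the repair queue -/
  c : ∀ i, S i → ℝ
  c_nonneg : ∀ i u, 0 ≤ c i u
  /-- probability that a repair completes in a slot in which it is being worked on -/
  s : Fin n → ℝ≥0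
  s_pos : ∀ i, 0 < s i
  s_le_one : ∀ i, s i ≤ 1
  /-- the state in which a machine leaves the repair -/
  ρ : ∀ i, S i
  /-- number of machines that can be under repair at the same time -/
  M : ℕ
  M_pos : 0 < M

/-- The status of a machine: active in a state, waiting in the repair queue (its repair has not
been started), or in the repair queue with its repair started and not yet completed. -/
inductive Status (A : Type u) : Type u
  | active (u : A)
  | queued
  | inRepair

/-- The three kinds of status as a sum type, used only to count them. -/
def Status.equivSum (A : Type u) : A ⊕ Bool ≃ Status A where
  toFun x := match x with
    | .inl u => .active u
    | .inr true => .queued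
    | .inr false => .inRepair
  invFun x := match x with
    | .active u => .inl u
    | .queued => .inr true
    | .inRepair => .inr false
  left_inv := by rintro (u | _ | _) <;> rfl
  right_inv := by rintro (u | _ | _) <;> rfl

instance (A : Type u) [Fintype A] : Fintype (Status A) := Fintype.ofEquiv _ (Status.equivSum A)

/-- The joint status of all machines at the beginning of a slot. -/
abbrev Config {n : ℕ} (S : Fin n → Type u) : Type u := ∀ i, Status (S i)

/-- The decision in a slot: the active machines that are moved to the repair queue (at the
beginning of the slot), and the machines in the queue that are worked on during the slot. -/
abbrev Decision (n : ℕ) : Type := Finset (Fin n) × Finset (Fin n)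

abbrev Decision.move {n : ℕ} (a : Decision n) : Finset (Fin n) := a.1

abbrev Decision.serve {n : ℕ} (a : Decision n) : Finset (Fin n) := a.2

/-- What has been observed up to the beginning of slot `t`: the initial configuration, and for
each earlier slot the decision taken and the configuration it led to. -/
def History {n : ℕ} (S : Fin n → Type u) : ℕ → Type u
  | 0 => Config S
  | t + 1 => History S t × Decision n × Config S

instance History.instFintype {n : ℕ} (S : Fin n → Type u) [∀ i, Fintype (S i)] :
    ∀ t, Fintype (History S t)
  | 0 => inferInstanceAs (Fintype (Config S))
  | t + 1 =>
    letI := History.instFintype S t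
    inferInstanceAs (Fintype (History S t × Decision n × Config S))

/-- The configuration at the beginning of slot `t`. -/
def History.current {n : ℕ} {S : Fin n → Type u} : {t : ℕ} → History S t → Config S
  | 0, h => h
  | _ + 1, h => h.2.2

/-- A scheduling policy: a randomized decision for every history. -/
abbrev Policy {n : ℕ} (S : Fin n → Type u) : Type u := ∀ t, History S t → PMF (Decision n)

/-- The law of independent random variables with laws `q i`. -/
noncomputable def independent {n : ℕ} {A : Fin n → Type u} [∀ i, Fintype (A i)]
    (q : ∀ i, PMF (A i)) : PMF (∀ i, A i) :=
  PMF.ofFintype (fun a => ∏ i, q i (a i)) (by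
    have h := Finset.prod_univ_sum (fun i => (Finset.univ : Finset (A i))) (fun i a => q i a)
    rw [Fintype.piFinset_univ] at h
    rw [← h]
    refine Finset.prod_eq_one fun i _ => ?_
    rw [← tsum_fintype (L := .unconditional _)]
    exact (q i).tsum_coe)

/-- `true` with probability `s`. -/
noncomputable def coin (s : ℝ≥0) (hs : s ≤ 1) : PMF Bool :=
  PMF.ofFintype (fun b => if b then (s : ℝ≥0∞) else 1 - (s : ℝ≥0∞)) (by
    have : (s : ℝ≥0∞) ≤ 1 := by exact_mod_cast hs
    simp [this])

namespace Model

variable {n : ℕ} {S : Fin n → Type u} (I : Model n S)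

/-- The distribution of the status of machine `i` at the beginning of the next slot. -/
noncomputable def machineStep (a : Decision n) (i : Fin n) (σ : Status (S i)) :
    PMF (Status (S i)) :=
  if i ∈ a.serve then
    (coin (I.s i) (I.s_le_one i)).map fun done => if done then .active (I.ρ i) else .inRepair
  else match σ with
    | .active u => if i ∈ a.move then PMF.pure .queued else (I.p i u).map .active
    | .queued => PMF.pure .queued
    | .inRepair => PMF.pure .inRepair

/-- Reward minus cost of machine `i` in the current slot. -/
noncomputable def machineReward (a : Decision n) (i : Fin n) (σ : Status (S i)) : ℝ :=
  match σ with
  | .active u => if i ∈ a.move then -I.c i u else I.r i u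
  | .queued => 0
  | .inRepair => 0

/-- Reward minus cost of all machines in the current slot. -/
noncomputable def reward (σ : Config S) (a : Decision n) : ℝ :=
  ∑ i, I.machineReward a i (σ i)

/-- Machine `i` is in the repair queue after the moves of the current slot. -/
def InQueue (σ : Config S) (a : Decision n) (i : Fin n) : Prop :=
  i ∈ a.move ∨ σ i = .queued ∨ σ i = .inRepair

/-- The constraints on a decision: only active machines are moved to the queue, only machines in
the queue are worked on, repairs that have been started are not interrupted, and at most `M`
machines are worked on. -/
structure Feasible (σ : Config S) (a : Decision n) : Prop where
  move_active : ∀ i ∈ a.move, ∃ u, σ i = .active u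
  serve_inQueue : ∀ i ∈ a.serve, InQueue σ a i
  nonpreemptive : ∀ i, σ i = .inRepair → i ∈ a.serve
  capacity : a.serve.card ≤ I.M

section Dynamics

variable [∀ i, Fintype (S i)]

/-- The law of the next configuration; the machines evolve independently. -/
noncomputable def step (σ : Config S) (a : Decision n) : PMF (Config S) :=
  independent fun i => I.machineStep a i (σ i)

/-- The law of the history up to slot `t` when machine `i` starts in the active state `σ₀ i`. -/
noncomputable def law (σ₀ : ∀ i, S i) (π : Policy S) : (t : ℕ) → PMF (History S t)
  | 0 => PMF.pure (fun i => Status.active (σ₀ i) : Config S)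
  | t + 1 => (law σ₀ π t).bind fun h => (π t h).bind fun a =>
      (I.step h.current a).map fun σ => (h, a, σ)

/-- The policy takes only feasible decisions, almost surely. -/
def Admissible (σ₀ : ∀ i, S i) (π : Policy S) : Prop :=
  ∀ t, ∀ h ∈ (I.law σ₀ π t).support, ∀ a ∈ (π t h).support, I.Feasible h.current a

/-- Expected reward minus cost in slot `t`. -/
noncomputable def expectedReward (σ₀ : ∀ i, S i) (π : Policy S) (t : ℕ) : ℝ :=
  ∑ h : History S t, (I.law σ₀ π t h).toReal *
    ∑ a : Decision n, (π t h a).toReal * I.reward h.current a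

/-- Expected time average of reward minus cost over the first `T` slots. -/
noncomputable def average (σ₀ : ∀ i, S i) (π : Policy S) (T : ℕ) : ℝ :=
  (∑ t ∈ range T, I.expectedReward σ₀ π t) / T

/-- The optimal long-run time average of reward minus cost, over all admissible policies and all
start states (evaluated through the limit superior). -/
noncomputable def optimalValue : EReal :=
  ⨆ (σ₀ : ∀ i, S i) (π : Policy S) (_ : I.Admissible σ₀ π),
    limsup (fun T => (I.average σ₀ π T : EReal)) atTop

/-- The guaranteed long-run time average of a policy (evaluated through the limit inferior). -/
noncomputable def guaranteedValue (σ₀ : ∀ i, S i) (π : Policy S) : EReal :=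
  liminf (fun T => (I.average σ₀ π T : EReal)) atTop

end Dynamics

/-- One-step transition probability as a real number. -/
noncomputable def prob (i : Fin n) (u v : S i) : ℝ := (I.p i u v).toReal

/-- The active chain of machine `i` has a single recurrent class: some state is reachable from
every state. -/
def Unichain (i : Fin n) : Prop :=
  ∃ w, ∀ u, Relation.ReflTransGen (fun a b => 0 < I.prob i a b) u w

end Model

/-- Variables of the balanced dual program. -/
structure DualVars {n : ℕ} (S : Fin n → Type u) where
  lam : ℝ
  h : Fin n → ℝ
  phi : ∀ i, S i → ℝ

/-- Variables of the balanced primal program (the linear programming dual of the balanced dual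
program): `x i u` and `z i u` for active states `u`, `xκ i` for the state of being repaired, and
`ω` for the multiplier of the balance constraint. -/
structure PrimalVars {n : ℕ} (S : Fin n → Type u) where
  x : ∀ i, S i → ℝ
  xκ : Fin n → ℝ
  z : ∀ i, S i → ℝ
  ω : ℝ

namespace Model

variable {n : ℕ} {S : Fin n → Type u} [∀ i, Fintype (S i)] (I : Model n S)

noncomputable def dualObjective (D : DualVars S) : ℝ := I.M * D.lam + ∑ i, D.h i

structure DualFeasible (D : DualVars S) : Prop where
  repair : ∀ i, D.lam + D.h i ≥ I.s i * D.phi i (I.ρ i)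
  active : ∀ i u, D.h i ≥ I.r i u + ∑ v, I.prob i u v * (D.phi i v - D.phi i u)
  move : ∀ i u, D.phi i u + I.c i u ≥ 0
  balance : I.M * D.lam = ∑ i, D.h i
  lam_nonneg : 0 ≤ D.lam
  h_nonneg : ∀ i, 0 ≤ D.h i

/-- Optimal solution of the balanced dual (a minimization problem). -/
def DualOptimal (D : DualVars S) : Prop :=
  I.DualFeasible D ∧ ∀ D', I.DualFeasible D' → I.dualObjective D ≤ I.dualObjective D'

noncomputable def primalObjective (P : PrimalVars S) : ℝ :=
  ∑ i, ∑ u, (I.r i u * P.x i u - I.c i u * P.z i u)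

structure PrimalFeasible [∀ i, DecidableEq (S i)] (P : PrimalVars S) : Prop where
  capacity : ∑ i, P.xκ i ≤ I.M * (1 + P.ω)
  mass : ∀ i, P.xκ i + ∑ u, P.x i u ≤ 1 - P.ω
  flow : ∀ i u, (if u = I.ρ i then I.s i * P.xκ i else 0)
      + ∑ v ∈ univ.erase u, P.x i v * I.prob i v u
    = P.z i u + ∑ v ∈ univ.erase u, P.x i u * I.prob i u v
  x_nonneg : ∀ i u, 0 ≤ P.x i u
  xκ_nonneg : ∀ i, 0 ≤ P.xκ i
  z_nonneg : ∀ i u, 0 ≤ P.z i u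

/-- Optimal solution of the balanced primal (a maximization problem). -/
def PrimalOptimal [∀ i, DecidableEq (S i)] (P : PrimalVars S) : Prop :=
  I.PrimalFeasible P ∧ ∀ P', I.PrimalFeasible P' → I.primalObjective P' ≤ I.primalObjective P

/-- Start states covered by the guarantee: every machine `i` with `h i > 0` starts in a state
charged by the primal solution, or it starts in `ρ i` and its active chain has a single recurrent
class. -/
def GoodStart (D : DualVars S) (P : PrimalVars S) (σ₀ : ∀ i, S i) : Prop :=
  ∀ i, 0 < D.h i →
    0 < P.x i (σ₀ i) + P.z i (σ₀ i) ∨ (σ₀ i = I.ρ i ∧ I.Unichain i)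

/-- The balanced decision rule: machine `i` is moved to the repair queue exactly when `h i > 0` and
it is in an active state `u` with `z i u > 0`; as many machines in the queue as the capacity allows
are worked on, and these are otherwise arbitrary. -/
structure BalancedDecision (D : DualVars S) (P : PrimalVars S) (σ : Config S) (a : Decision n) :
    Prop where
  feasible : I.Feasible σ a
  move_iff : ∀ i, i ∈ a.move ↔ 0 < D.h i ∧ ∃ u, σ i = .active u ∧ 0 < P.z i u
  busy : a.serve.card = min I.M {i | InQueue σ a i}.ncard

/-- The policy started from `σ₀` follows the balanced decision rule, almost surely. -/
def IsBalancedPolicy (D : DualVars S) (P : PrimalVars S) (σ₀ : ∀ i, S i) (π : Policy S) : Prop :=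
  ∀ t, ∀ h ∈ (I.law σ₀ π t).support, ∀ a ∈ (π t h).support,
    I.BalancedDecision D P h.current a

end Model

end Replenishment

/-! The theorem is an application of linear programming duality. Complementary slackness says which
inequalities of the balanced dual program are tight on the states that the primal solution charges.

Add to the reward of each slot the expected increase of the potential `∑ φ_u`, where the sum is over
the states `u` of the active machines. As these increases telescope, the long-run average does not
change. Under any feasible decision the dual constraints bound the adjusted reward of a slot by
`M λ + ∑ h_i`, whence `OPT ≤ M λ + ∑ h_i = 2 M λ`. Under a balanced policy complementary slackness
turns the constraints around: a machine that is worked on earns at least `λ + h_i`, a running one at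
least `h_i`, and a waiting one at least `0`. Either `M` machines are worked on, and they earn at
least `M λ`, or no machine waits, and together they earn at least `∑ h_i = M λ`.

A machine that starts in an uncharged `ρ_i` is never repaired in the primal solution, hence never
moved by a balanced policy. If its chain has a single recurrent class, then adding to `φ` a large
multiple of a function with positive drift outside of the charged states restores the bound `h_i`.
-/

namespace Replenishment

/-! ### Linear programming duality -/

section LinearProgramming

variable {ι 𝕜 V : Type*} [Field 𝕜] [LinearOrder 𝕜] [IsStrictOrderedRing 𝕜]
  [AddCommGroup V] [Module 𝕜 V]

theorem exists_nonneg_eq_smul_add_sum {s : Finset ι} {f : ι → Module.Dual 𝕜 V}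
    {f₀ g : Module.Dual 𝕜 V} {v : V} {c : ι → 𝕜} (hf₀ : f₀ v < 0) (hf : ∀ j ∈ s, 0 ≤ f j v)
    (hg : g v ≤ 0) (hc : ∀ j, 0 ≤ c j)
    (h : g - (g v / f₀ v) • f₀ = ∑ j ∈ s, c j • (f j - (f j v / f₀ v) • f₀)) :
    ∃ d : 𝕜, 0 ≤ d ∧ g = d • f₀ + ∑ j ∈ s, c j • f j := by
  have hsum : 0 ≤ ∑ j ∈ s, c j * f j v := sum_nonneg fun j hj => mul_nonneg (hc j) (hf j hj)
  refine ⟨(g v - ∑ j ∈ s, c j * f j v) / f₀ v, div_nonneg_of_nonpos (by linarith) hf₀.le, ?_⟩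
  simp only [smul_sub, smul_smul, sum_sub_distrib, ← sum_smul, ← mul_div_assoc, ← sum_div] at h
  refine (eq_add_of_sub_eq h).trans ?_
  module

/-- **Farkas' lemma**. -/
theorem exists_nonneg_eq_sum_smul_of_forall_nonneg (s : Finset ι) (f : ι → Module.Dual 𝕜 V)
    (g : Module.Dual 𝕜 V) (hg : ∀ v, (∀ j ∈ s, 0 ≤ f j v) → 0 ≤ g v) :
    ∃ c : ι → 𝕜, (∀ j, 0 ≤ c j) ∧ g = ∑ j ∈ s, c j • f j := by
  classical
  induction s using Finset.induction_on generalizing f g with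
  | empty =>
    refine ⟨0, fun _ => le_rfl, LinearMap.ext fun v => ?_⟩
    have hneg := hg (-v) (by simp)
    rw [map_neg, neg_nonneg] at hneg
    simpa using hneg.antisymm (hg v (by simp))
  | insert a s ha ih =>
    suffices ∃ d : 𝕜, 0 ≤ d ∧ ∃ c : ι → 𝕜, (∀ j, 0 ≤ c j) ∧ g = d • f a + ∑ j ∈ s, c j • f j by
      obtain ⟨d, hd, c, hc, rfl⟩ := this
      refine ⟨Function.update c a d, fun j => ?_, ?_⟩
      · rcases eq_or_ne j a with rfl | hj
        · simpa using hd
        · simpa [hj] using hc j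
      · rw [sum_insert ha, Function.update_self]
        congr 1
        exact sum_congr rfl fun j hj => by
          rw [Function.update_of_ne (ne_of_mem_of_not_mem hj ha)]
    by_cases h : ∀ v, (∀ j ∈ s, 0 ≤ f j v) → 0 ≤ g v
    · obtain ⟨c, hc, hgc⟩ := ih f g h
      exact ⟨0, le_rfl, c, hc, by rwa [zero_smul, zero_add]⟩
    push Not at h
    obtain ⟨v, hv, hgv⟩ := h
    have hav : f a v < 0 := by
      by_contra! hcon
      exact hgv.not_ge (hg v (forall_mem_insert _ _ _ |>.2 ⟨hcon, hv⟩))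
    -- These are `f j` and `g` composed with the projection along `v` onto the kernel of `f a`.
    obtain ⟨c, hc, hgc⟩ := ih (fun j => f j - (f j v / f a v) • f a) (g - (g v / f a v) • f a) (by
      intro w hw
      have key := hg (w - (f a w / f a v) • v) (forall_mem_insert _ _ _ |>.2
        ⟨by simp [hav.ne], fun j hj => (hw j hj).trans_eq (by simp; ring)⟩)
      exact key.trans_eq (by simp; ring))
    obtain ⟨d, hd, hgd⟩ := exists_nonneg_eq_smul_add_sum hav hv hgv.le hc hgc
    exact ⟨d, hd, c, hc, hgd⟩

/-- The polyhedron cut out by the inequalities `b j ≤ f j v`. -/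
def polyhedron (f : ι → Module.Dual 𝕜 V) (b : ι → 𝕜) : Set V := {v | ∀ j, b j ≤ f j v}

theorem exists_nonneg_sum_smul_eq_zero_of_polyhedron_eq_empty [Fintype ι] {f : ι → Module.Dual 𝕜 V}
    {b : ι → 𝕜} (h : polyhedron f b = ∅) :
    ∃ c : ι → 𝕜, (∀ j, 0 ≤ c j) ∧ ∑ j, c j • f j = 0 ∧ 0 < ∑ j, c j * b j := by
  let t := LinearMap.snd 𝕜 V 𝕜
  obtain ⟨c, hc, hgc⟩ := exists_nonneg_eq_sum_smul_of_forall_nonneg univ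
    (fun j => f j ∘ₗ LinearMap.fst 𝕜 V 𝕜 - b j • t) (-t) (by
      rintro ⟨v, τ⟩ hv
      by_contra! hτ
      replace hτ : 0 < τ := by simpa [t] using hτ
      refine Set.eq_empty_iff_forall_notMem.1 h (τ⁻¹ • v) fun j => ?_
      have hj : b j * τ ≤ f j v := by simpa [t] using hv j (mem_univ j)
      rwa [map_smul, smul_eq_mul, le_inv_mul_iff₀ hτ, mul_comm])
  refine ⟨c, hc, LinearMap.ext fun v => ?_, ?_⟩
  · simpa [t] using (LinearMap.congr_fun hgc (v, 0)).symm
  · have hneg : (-1 : 𝕜) = -∑ j, c j * b j := by simpa [t] using LinearMap.congr_fun hgc (0, 1)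
    linarith

/-- The **Karush–Kuhn–Tucker conditions**. A direction in which no constraint that is active at `v₀`
decreases stays feasible for a while, so Farkas' lemma applies to the active constraints. -/
theorem exists_multipliers_of_isMinOn_polyhedron [Fintype ι] {f : ι → Module.Dual 𝕜 V} {b : ι → 𝕜}
    {g : Module.Dual 𝕜 V} {v₀ : V} (hv₀ : v₀ ∈ polyhedron f b)
    (hmin : IsMinOn g (polyhedron f b) v₀) :
    ∃ c : ι → 𝕜, (∀ j, 0 ≤ c j) ∧ g = ∑ j, c j • f j ∧ ∑ j, c j * b j = g v₀ := by
  classical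
  let active : Finset ι := {j | f j v₀ = b j}
  obtain ⟨c, hc, hgc⟩ := exists_nonneg_eq_sum_smul_of_forall_nonneg active f g (by
    intro w hw
    have hroom (j : ι) : ∃ ε : 𝕜, 0 < ε ∧ ∀ δ : 𝕜, 0 < δ → δ < ε → b j ≤ f j (v₀ + δ • w) := by
      simp only [map_add, map_smul, smul_eq_mul]
      rcases (hv₀ j).eq_or_lt with hj | hj
      · have hwj : 0 ≤ f j w := hw j (by simp [active, hj])
        exact ⟨1, one_pos, fun δ hδ _ => by nlinarith⟩
      · have hpos : 0 < |f j w| + 1 := by positivity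
        refine ⟨(f j v₀ - b j) / (|f j w| + 1), div_pos (sub_pos.2 hj) hpos, fun δ hδ hlt => ?_⟩
        rw [lt_div_iff₀ hpos] at hlt
        nlinarith [neg_abs_le (f j w)]
    choose ε hε hroom using hroom
    obtain ⟨δ, hδ, hδε⟩ := Pi.exists_forall_pos_add_lt hε
    have hle : g v₀ ≤ g (v₀ + δ • w) :=
      hmin fun j => hroom j δ hδ (by simpa using hδε j)
    rw [map_add, map_smul, smul_eq_mul, le_add_iff_nonneg_right] at hle
    exact nonneg_of_mul_nonneg_right hle hδ)
  refine ⟨fun j => if j ∈ active then c j else 0, fun j => ?_, ?_, ?_⟩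
  · dsimp only
    split_ifs
    exacts [hc j, le_rfl]
  · simpa [ite_smul, sum_ite_mem] using hgc
  · rw [hgc]
    simp only [ite_mul, zero_mul, sum_ite_mem, univ_inter, LinearMap.sum_apply,
      LinearMap.smul_apply, smul_eq_mul]
    exact sum_congr rfl fun j hj => by rw [(mem_filter.1 hj).2]

theorem exists_isMinOn_polyhedron [Finite ι] {V : Type*} [AddCommGroup V] [Module ℝ V]
    {f : ι → Module.Dual ℝ V} {b : ι → ℝ} {g : Module.Dual ℝ V}
    (hne : (polyhedron f b).Nonempty) (hbdd : BddBelow (g '' polyhedron f b)) :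
    ∃ v₀ ∈ polyhedron f b, IsMinOn g (polyhedron f b) v₀ := by
  cases nonempty_fintype ι
  by_contra! hcon
  set β := sInf (g '' polyhedron f b)
  have hempty : polyhedron (fun j : Option ι => j.elim (-g) f) (fun j => j.elim (-β) b) = ∅ := by
    refine Set.eq_empty_of_forall_notMem fun v hv => ?_
    have hgv : g v ≤ β := by simpa using hv none
    exact hcon v (fun j => hv (some j)) fun w hw => hgv.trans (csInf_le hbdd ⟨w, hw, rfl⟩)
  obtain ⟨c, hc, hsum, hpos⟩ := exists_nonneg_sum_smul_eq_zero_of_polyhedron_eq_empty hempty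
  simp only [Fintype.sum_option, Option.elim_none, Option.elim_some, smul_neg,
    neg_add_eq_zero] at hsum hpos
  have hle : ∀ v ∈ polyhedron f b, ∑ j, c (some j) * b j ≤ c none * g v := fun v hv =>
    calc ∑ j, c (some j) * b j ≤ ∑ j, c (some j) * f j v :=
          sum_le_sum fun j _ => mul_le_mul_of_nonneg_left (hv j) (hc _)
      _ = c none * g v := by simpa using (LinearMap.congr_fun hsum v).symm
  rcases (hc none).eq_or_lt with h0 | h0
  · obtain ⟨v, hv⟩ := hne
    have := hle v hv
    rw [← h0, zero_mul] at this hpos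
    linarith
  · have hβ : (∑ j, c (some j) * b j) / c none ≤ β := le_csInf (hne.image _) (by
      rintro _ ⟨v, hv, rfl⟩
      rw [div_le_iff₀ h0, mul_comm]
      exact hle v hv)
    rw [div_le_iff₀ h0] at hβ
    linarith

end LinearProgramming

theorem sum_toReal_pmf {α : Type*} [Fintype α] (μ : PMF α) : ∑ a, (μ a).toReal = 1 := by
  have h := μ.tsum_coe
  rw [tsum_fintype] at h
  rw [← ENNReal.toReal_sum fun a _ => μ.apply_ne_top a, h, ENNReal.toReal_one]

namespace Model

variable {n : ℕ} {S : Fin n → Type u} (I : Model n S)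

/-! ### The balanced programs -/

theorem prob_nonneg (i : Fin n) (u v : S i) : 0 ≤ I.prob i u v := ENNReal.toReal_nonneg

theorem natCast_M_pos : (0 : ℝ) < I.M := mod_cast I.M_pos

/-- The variables `(h, φ)` of the balanced dual program once the balance equation has been used to
eliminate `λ = (∑ i, h i) / M`. -/
abbrev DualSpace (S : Fin n → Type u) : Type u := (Fin n → ℝ) × ∀ i, S i → ℝ

/-- The inequalities of the balanced dual program: `repair i`, `0 ≤ h i`, `active i u`,
`move i u`. -/
abbrev DualIndex (S : Fin n → Type u) : Type u :=
  Fin n ⊕ Fin n ⊕ (Σ i, S i) ⊕ Σ i, S i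

/-- The coordinate `h i`. -/
def hCoord (i : Fin n) : Module.Dual ℝ (DualSpace S) :=
  LinearMap.proj i ∘ₗ LinearMap.fst ℝ _ _

/-- The coordinate `φ i u`. -/
def phiCoord (i : Fin n) (u : S i) : Module.Dual ℝ (DualSpace S) :=
  LinearMap.proj u ∘ₗ LinearMap.proj i ∘ₗ LinearMap.snd ℝ _ _

@[simp]
theorem hCoord_apply (i : Fin n) (v : DualSpace S) : hCoord i v = v.1 i := rfl

@[simp]
theorem phiCoord_apply (i : Fin n) (u : S i) (v : DualSpace S) : phiCoord i u v = v.2 i u := rfl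

/-- The constant parts of the inequalities of the balanced dual program. -/
def dualBound : DualIndex S → ℝ
  | .inl _ => 0
  | .inr (.inl _) => 0
  | .inr (.inr (.inl ⟨i, u⟩)) => I.r i u
  | .inr (.inr (.inr ⟨i, u⟩)) => -I.c i u

/-- The objective `M λ + ∑ i, h i` in terms of `h`. -/
def dualSpaceObjective : Module.Dual ℝ (DualSpace S) := (2 : ℝ) • ∑ i, hCoord i

/-- The solution of the balanced dual program with given `h` and `φ`. -/
noncomputable def toDualVars (v : DualSpace S) : DualVars S := ⟨(∑ i, v.1 i) / I.M, v.1, v.2⟩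

theorem dualObjective_toDualVars (v : DualSpace S) :
    I.dualObjective (I.toDualVars v) = dualSpaceObjective v := by
  simp only [dualObjective, toDualVars, dualSpaceObjective, mul_div_cancel₀ _ I.natCast_M_pos.ne',
    LinearMap.smul_apply, LinearMap.sum_apply, hCoord_apply, smul_eq_mul]
  ring

variable [∀ i, Fintype (S i)]

theorem DualFeasible.dualObjective_eq {I : Model n S} {D : DualVars S} (hD : I.DualFeasible D) :
    I.dualObjective D = 2 * (I.M * D.lam) := by
  rw [dualObjective, ← hD.balance, two_mul]

theorem sum_prob (i : Fin n) (u : S i) : ∑ v, I.prob i u v = 1 := sum_toReal_pmf (I.p i u)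

theorem sum_prob_mul_sub (i : Fin n) (u : S i) (φ : S i → ℝ) :
    ∑ v, I.prob i u v * (φ v - φ u) = ∑ v, I.prob i u v * φ v - φ u := by
  simp only [mul_sub, sum_sub_distrib, ← sum_mul, sum_prob, one_mul]

/-- The variable parts of the inequalities of the balanced dual program. -/
noncomputable def dualFunctional : DualIndex S → Module.Dual ℝ (DualSpace S)
  | .inl i => (I.M : ℝ)⁻¹ • ∑ j, hCoord j + hCoord i - (I.s i : ℝ) • phiCoord i (I.ρ i)
  | .inr (.inl i) => hCoord i
  | .inr (.inr (.inl ⟨i, u⟩)) =>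
      hCoord i + phiCoord i u - ∑ v, I.prob i u v • phiCoord i v
  | .inr (.inr (.inr ⟨i, u⟩)) => phiCoord i u

theorem dualFeasible_toDualVars {v : DualSpace S}
    (hv : v ∈ polyhedron I.dualFunctional I.dualBound) : I.DualFeasible (I.toDualVars v) := by
  have hh (i) : 0 ≤ v.1 i := hv (.inr (.inl i))
  refine ⟨fun i => ?_, fun i u => ?_, fun i u => ?_, mul_div_cancel₀ _ I.natCast_M_pos.ne',
    div_nonneg (sum_nonneg fun i _ => hh i) I.natCast_M_pos.le, hh⟩
  · have := hv (.inl i)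
    simp only [dualFunctional, dualBound, LinearMap.sub_apply, LinearMap.add_apply,
      LinearMap.smul_apply, LinearMap.sum_apply, hCoord_apply, phiCoord_apply, smul_eq_mul,
      inv_mul_eq_div] at this
    simp only [toDualVars]
    linarith
  · have := hv (.inr (.inr (.inl ⟨i, u⟩)))
    simp only [dualFunctional, dualBound, LinearMap.sub_apply, LinearMap.add_apply,
      LinearMap.smul_apply, LinearMap.sum_apply, hCoord_apply, phiCoord_apply,
      smul_eq_mul] at this
    rw [sum_prob_mul_sub]
    simp only [toDualVars]
    linarith
  · have : -I.c i u ≤ v.2 i u := hv (.inr (.inr (.inr ⟨i, u⟩)))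
    simp only [toDualVars]
    linarith

theorem polyhedron_dualFunctional_nonempty :
    (polyhedron I.dualFunctional I.dualBound).Nonempty := by
  have hr (i) : 0 ≤ ∑ u, I.r i u := sum_nonneg fun u _ => I.r_nonneg i u
  refine ⟨(fun i => ∑ u, I.r i u, 0), ?_⟩
  rintro (i | i | ⟨i, u⟩ | ⟨i, u⟩)
  · have : 0 ≤ (I.M : ℝ)⁻¹ * ∑ j, ∑ u, I.r j u :=
      mul_nonneg (inv_nonneg.2 I.natCast_M_pos.le) (sum_nonneg fun j _ => hr j)
    simpa [dualFunctional, dualBound] using add_nonneg this (hr i)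
  · exact hr i
  · simpa [dualFunctional, dualBound] using
      single_le_sum (fun v _ => I.r_nonneg i v) (mem_univ u)
  · simpa [dualFunctional, dualBound] using I.c_nonneg i u

theorem exists_isMinOn_dualSpaceObjective :
    ∃ v ∈ polyhedron I.dualFunctional I.dualBound,
      IsMinOn dualSpaceObjective (polyhedron I.dualFunctional I.dualBound) v := by
  refine exists_isMinOn_polyhedron I.polyhedron_dualFunctional_nonempty ⟨0, ?_⟩
  rintro _ ⟨v, hv, rfl⟩
  have : 0 ≤ ∑ i, v.1 i := sum_nonneg fun i _ => hv (.inr (.inl i))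
  simpa [dualSpaceObjective] using this

/-- The solution of the balanced primal program read off from multipliers of the inequalities of
the balanced dual program. -/
noncomputable def primalOfMultipliers (w : DualIndex S → ℝ) : PrimalVars S where
  x i u := w (.inr (.inr (.inl ⟨i, u⟩)))
  xκ i := w (.inl i)
  z i u := w (.inr (.inr (.inr ⟨i, u⟩)))
  ω := (∑ i, w (.inl i)) / I.M - 1

theorem primalObjective_primalOfMultipliers (w : DualIndex S → ℝ) :
    I.primalObjective (I.primalOfMultipliers w) = ∑ j, w j * I.dualBound j := by
  simp only [primalObjective, primalOfMultipliers, Fintype.sum_sum_type, Fintype.sum_sigma,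
    dualBound, mul_zero, sum_const_zero, zero_add, mul_neg, sum_neg_distrib, sub_eq_add_neg,
    sum_add_distrib, mul_comm (I.r _ _), mul_comm (I.c _ _)]

theorem sum_smul_dualFunctional_apply (w : DualIndex S → ℝ) (v : DualSpace S) :
    (∑ j, w j • I.dualFunctional j) v =
      ∑ i, (w (.inl i) * ((∑ j, v.1 j) / I.M + v.1 i - I.s i * v.2 i (I.ρ i)) +
        (w (.inr (.inl i)) * v.1 i +
        (∑ u, w (.inr (.inr (.inl ⟨i, u⟩))) *
          (v.1 i + v.2 i u - ∑ u', I.prob i u u' * v.2 i u') +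
        ∑ u, w (.inr (.inr (.inr ⟨i, u⟩))) * v.2 i u))) := by
  simp only [LinearMap.sum_apply, LinearMap.smul_apply, Fintype.sum_sum_type, Fintype.sum_sigma,
    dualFunctional, LinearMap.sub_apply, LinearMap.add_apply, hCoord_apply, phiCoord_apply,
    smul_eq_mul, inv_mul_eq_div, sum_add_distrib]

section Primal

variable [∀ i, DecidableEq (S i)]

theorem flow_iff_sum_univ (P : PrimalVars S) (i : Fin n) (u : S i) :
    ((if u = I.ρ i then I.s i * P.xκ i else 0) + ∑ v ∈ univ.erase u, P.x i v * I.prob i v u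
      = P.z i u + ∑ v ∈ univ.erase u, P.x i u * I.prob i u v) ↔
    (if u = I.ρ i then I.s i * P.xκ i else 0) + ∑ v, P.x i v * I.prob i v u
      = P.z i u + P.x i u := by
  have hin := add_sum_erase univ (fun v => P.x i v * I.prob i v u) (mem_univ u)
  have hout := add_sum_erase univ (fun v => P.x i u * I.prob i u v) (mem_univ u)
  rw [← mul_sum univ, sum_prob, mul_one] at hout
  constructor <;> intro h <;> linarith

theorem primalFeasible_primalOfMultipliers {w : DualIndex S → ℝ} (hw : ∀ j, 0 ≤ w j)
    (heq : dualSpaceObjective = ∑ j, w j • I.dualFunctional j) :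
    I.PrimalFeasible (I.primalOfMultipliers w) := by
  refine ⟨?_, fun i => ?_, fun i u => (I.flow_iff_sum_univ _ i u).2 ?_, fun i u => hw _,
    fun i => hw _, fun i u => hw _⟩
  · simp [primalOfMultipliers, mul_div_cancel₀ _ I.natCast_M_pos.ne']
  · have htest := LinearMap.congr_fun heq (Pi.single i 1, 0)
    rw [sum_smul_dualFunctional_apply] at htest
    have hmass : 2 = (∑ j, w (.inl j)) / I.M + w (.inl i) +
        (w (.inr (.inl i)) + ∑ u, w (.inr (.inr (.inl ⟨i, u⟩)))) := by
      simpa [dualSpaceObjective, mul_add, sum_add_distrib, Pi.single_apply, ← div_eq_mul_inv,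
        ← sum_div] using htest
    have := hw (.inr (.inl i))
    simp only [primalOfMultipliers]
    linarith
  · have htest := LinearMap.congr_fun heq (0, Pi.single i (Pi.single u 1))
    rw [sum_smul_dualFunctional_apply, Fintype.sum_eq_single i fun j hj => by simp [hj]] at htest
    have hflow : 0 = -(if u = I.ρ i then I.s i * w (.inl i) else 0) +
        (w (.inr (.inr (.inl ⟨i, u⟩))) - ∑ v, w (.inr (.inr (.inl ⟨i, v⟩))) * I.prob i v u +
        w (.inr (.inr (.inr ⟨i, u⟩)))) := by
      simpa [dualSpaceObjective, Pi.single_apply, mul_sub, eq_comm (b := u), mul_comm (w (.inl i))]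
        using htest
    simp only [primalOfMultipliers]
    linarith

theorem exists_feasible_pair : ∃ (D : DualVars S) (P : PrimalVars S),
    I.DualFeasible D ∧ I.PrimalFeasible P ∧ I.dualObjective D = I.primalObjective P := by
  obtain ⟨v, hv, hmin⟩ := I.exists_isMinOn_dualSpaceObjective
  obtain ⟨w, hw, heq, hval⟩ := exists_multipliers_of_isMinOn_polyhedron hv hmin
  exact ⟨_, _, I.dualFeasible_toDualVars hv, I.primalFeasible_primalOfMultipliers hw heq, by
    rw [dualObjective_toDualVars, primalObjective_primalOfMultipliers, hval]⟩

variable {I} {D : DualVars S} {P : PrimalVars S}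

namespace PrimalFeasible

theorem sum_inflow_eq (hP : I.PrimalFeasible P) (i : Fin n) (u : S i) :
    (if u = I.ρ i then I.s i * P.xκ i else 0) + ∑ v, P.x i v * I.prob i v u
      = P.z i u + P.x i u :=
  (I.flow_iff_sum_univ P i u).1 (hP.flow i u)

theorem flow_pairing (hP : I.PrimalFeasible P) (i : Fin n) (f : S i → ℝ) :
    P.xκ i * (I.s i * f (I.ρ i)) + ∑ u, P.x i u * ∑ v, I.prob i u v * f v
      = ∑ u, P.z i u * f u + ∑ u, P.x i u * f u := by
  have h : ∑ u, ((if u = I.ρ i then I.s i * P.xκ i else 0) + ∑ v, P.x i v * I.prob i v u) * f u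
      = ∑ u, (P.z i u + P.x i u) * f u :=
    sum_congr rfl fun u _ => by rw [hP.sum_inflow_eq i u]
  simp only [add_mul, sum_add_distrib, ite_mul, zero_mul, sum_ite_eq', mem_univ, if_true,
    sum_mul] at h
  rw [sum_comm] at h
  simp only [mul_sum, ← h]
  congr 1
  · ring
  · exact sum_congr rfl fun u _ => sum_congr rfl fun v _ => by ring

theorem sum_z (hP : I.PrimalFeasible P) (i : Fin n) : ∑ u, P.z i u = I.s i * P.xκ i := by
  have h := hP.flow_pairing i 1
  simp only [Pi.one_apply, mul_one, sum_prob] at h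
  linarith

end PrimalFeasible

section Slackness

/-- The part of the duality gap that belongs to machine `i`: each variable of one program is
multiplied by the slack of the corresponding constraint of the other. -/
noncomputable def machineGap (I : Model n S) (D : DualVars S) (P : PrimalVars S) (i : Fin n) : ℝ :=
  D.h i * (1 - P.ω - (P.xκ i + ∑ u, P.x i u)) +
  P.xκ i * (D.lam + D.h i - I.s i * D.phi i (I.ρ i)) +
  ∑ u, P.x i u * (D.h i - (I.r i u + ∑ v, I.prob i u v * (D.phi i v - D.phi i u))) +
  ∑ u, P.z i u * (D.phi i u + I.c i u)

theorem machineGap_eq (hP : I.PrimalFeasible P) (i : Fin n) :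
    I.machineGap D P i = D.h i - P.ω * D.h i + D.lam * P.xκ i
      - ∑ u, (I.r i u * P.x i u - I.c i u * P.z i u) := by
  have hflow := hP.flow_pairing i (D.phi i)
  simp only [machineGap, sum_prob_mul_sub]
  simp only [mul_sub, mul_add, sum_sub_distrib, sum_add_distrib, ← sum_mul, mul_comm (I.r i _),
    mul_comm (I.c i _)]
  linarith

theorem machineGap_summands_nonneg (hD : I.DualFeasible D) (hP : I.PrimalFeasible P) (i : Fin n) :
    0 ≤ D.h i * (1 - P.ω - (P.xκ i + ∑ u, P.x i u)) ∧
    0 ≤ P.xκ i * (D.lam + D.h i - I.s i * D.phi i (I.ρ i)) ∧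
    (∀ u, 0 ≤
      P.x i u * (D.h i - (I.r i u + ∑ v, I.prob i u v * (D.phi i v - D.phi i u)))) ∧
    ∀ u, 0 ≤ P.z i u * (D.phi i u + I.c i u) :=
  ⟨mul_nonneg (hD.h_nonneg i) (sub_nonneg.2 (hP.mass i)),
    mul_nonneg (hP.xκ_nonneg i) (sub_nonneg.2 (hD.repair i)),
    fun u => mul_nonneg (hP.x_nonneg i u) (sub_nonneg.2 (hD.active i u)),
    fun u => mul_nonneg (hP.z_nonneg i u) (hD.move i u)⟩

theorem machineGap_nonneg (hD : I.DualFeasible D) (hP : I.PrimalFeasible P) (i : Fin n) :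
    0 ≤ I.machineGap D P i := by
  obtain ⟨hmass, hrepair, hactive, hmove⟩ := machineGap_summands_nonneg hD hP i
  exact add_nonneg (add_nonneg (add_nonneg hmass hrepair) (sum_nonneg fun u _ => hactive u))
    (sum_nonneg fun u _ => hmove u)

theorem dualObjective_sub_primalObjective (hD : I.DualFeasible D) (hP : I.PrimalFeasible P) :
    I.dualObjective D - I.primalObjective P =
      D.lam * (I.M * (1 + P.ω) - ∑ i, P.xκ i) + ∑ i, I.machineGap D P i := by
  simp only [machineGap_eq hP, sum_add_distrib, sum_sub_distrib, ← mul_sum, dualObjective,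
    primalObjective]
  linear_combination (-P.ω) * hD.balance

theorem primalObjective_le_dualObjective (hD : I.DualFeasible D) (hP : I.PrimalFeasible P) :
    I.primalObjective P ≤ I.dualObjective D := by
  rw [← sub_nonneg, dualObjective_sub_primalObjective hD hP]
  exact add_nonneg (mul_nonneg hD.lam_nonneg (sub_nonneg.2 hP.capacity))
    (sum_nonneg fun i _ => machineGap_nonneg hD hP i)

variable (I) in
theorem exists_optimal_pair : ∃ (D : DualVars S) (P : PrimalVars S),
    I.DualOptimal D ∧ I.PrimalOptimal P ∧ I.dualObjective D = I.primalObjective P := by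
  obtain ⟨D, P, hD, hP, heq⟩ := I.exists_feasible_pair
  exact ⟨D, P, ⟨hD, fun D' hD' => heq.trans_le (primalObjective_le_dualObjective hD' hP)⟩,
    ⟨hP, fun P' hP' => (primalObjective_le_dualObjective hD hP').trans_eq heq⟩, heq⟩

theorem dualObjective_eq_primalObjective (hD : I.DualOptimal D) (hP : I.PrimalOptimal P) :
    I.dualObjective D = I.primalObjective P := by
  obtain ⟨D', P', hD', hP', heq⟩ := I.exists_optimal_pair
  rw [(hD.2 D' hD'.1).antisymm (hD'.2 D hD.1), heq]
  exact (hP.2 P' hP'.1).antisymm (hP'.2 P hP.1)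

/-- The complementary slackness conditions, except the one for the capacity constraint. -/
structure ComplementarySlack (I : Model n S) (D : DualVars S) (P : PrimalVars S) : Prop where
  mass : ∀ i, 0 < D.h i → P.xκ i + ∑ u, P.x i u = 1 - P.ω
  repair : ∀ i, 0 < P.xκ i → D.lam + D.h i = I.s i * D.phi i (I.ρ i)
  active : ∀ i u, 0 < P.x i u →
    D.h i = I.r i u + ∑ v, I.prob i u v * (D.phi i v - D.phi i u)
  move : ∀ i u, 0 < P.z i u → D.phi i u + I.c i u = 0

theorem machineGap_eq_zero (hD : I.DualOptimal D) (hP : I.PrimalOptimal P) (i : Fin n) :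
    I.machineGap D P i = 0 := by
  have hgap := dualObjective_sub_primalObjective hD.1 hP.1
  rw [dualObjective_eq_primalObjective hD hP, sub_self] at hgap
  have hcap := mul_nonneg hD.1.lam_nonneg (sub_nonneg.2 hP.1.capacity)
  have hnonneg := fun i (_ : i ∈ univ) => machineGap_nonneg hD.1 hP.1 i
  have hsum : ∑ i, I.machineGap D P i = 0 := by linarith [sum_nonneg hnonneg]
  exact (sum_eq_zero_iff_of_nonneg hnonneg).1 hsum i (mem_univ i)

theorem complementarySlack (hD : I.DualOptimal D) (hP : I.PrimalOptimal P) :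
    I.ComplementarySlack D P := by
  have hzero (i) :
      ((D.h i * (1 - P.ω - (P.xκ i + ∑ u, P.x i u)) = 0 ∧
        P.xκ i * (D.lam + D.h i - I.s i * D.phi i (I.ρ i)) = 0) ∧
      ∀ u, P.x i u * (D.h i - (I.r i u + ∑ v, I.prob i u v * (D.phi i v - D.phi i u))) = 0) ∧
      ∀ u, P.z i u * (D.phi i u + I.c i u) = 0 := by
    obtain ⟨hmass, hrepair, hactive, hmove⟩ := machineGap_summands_nonneg hD.1 hP.1 i
    have hgap := machineGap_eq_zero hD hP i
    have hactive' := sum_nonneg fun u (_ : u ∈ univ) => hactive u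
    rw [machineGap, add_eq_zero_iff_of_nonneg (add_nonneg (add_nonneg hmass hrepair) hactive')
        (sum_nonneg fun u _ => hmove u),
      add_eq_zero_iff_of_nonneg (add_nonneg hmass hrepair) hactive',
      add_eq_zero_iff_of_nonneg hmass hrepair, sum_eq_zero_iff_of_nonneg fun u _ => hactive u,
      sum_eq_zero_iff_of_nonneg fun u _ => hmove u] at hgap
    simpa only [mem_univ, true_imp_iff] using hgap
  refine ⟨fun i hi => ?_, fun i hi => ?_, fun i u hu => ?_, fun i u hu => ?_⟩
  · exact (sub_eq_zero.1 ((mul_eq_zero.1 (hzero i).1.1.1).resolve_left hi.ne')).symm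
  · exact sub_eq_zero.1 ((mul_eq_zero.1 (hzero i).1.1.2).resolve_left hi.ne')
  · exact sub_eq_zero.1 ((mul_eq_zero.1 ((hzero i).1.2 u)).resolve_left hu.ne')
  · exact (mul_eq_zero.1 ((hzero i).2 u)).resolve_left hu.ne'

end Slackness

section Charged

/-- The primal solution `P` charges the state `u` of machine `i`: the machine is kept or moved in
`u` with positive frequency. -/
def _root_.Replenishment.PrimalVars.Charged {n : ℕ} {S : Fin n → Type u} (P : PrimalVars S)
    (i : Fin n) (u : S i) : Prop :=
  0 < P.x i u + P.z i u

namespace PrimalFeasible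

theorem xκ_pos_of_z_pos (hP : I.PrimalFeasible P) {i : Fin n} {u : S i} (hu : 0 < P.z i u) :
    0 < P.xκ i := by
  have h : 0 < ∑ u, P.z i u := sum_pos' (fun v _ => hP.z_nonneg i v) ⟨u, mem_univ u, hu⟩
  rw [hP.sum_z] at h
  exact pos_of_mul_pos_right h (I.s i).2

theorem x_pos_of_charged (hP : I.PrimalFeasible P) {i : Fin n} {u : S i} (hu : P.Charged i u)
    (hz : ¬ 0 < P.z i u) : 0 < P.x i u := by
  rwa [PrimalVars.Charged, (not_lt.1 hz).antisymm (hP.z_nonneg i u), add_zero] at hu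

theorem charged_of_xκ_pos (hP : I.PrimalFeasible P) {i : Fin n} (hi : 0 < P.xκ i) :
    P.Charged i (I.ρ i) := by
  have hflow := hP.sum_inflow_eq i (I.ρ i)
  have hin : 0 ≤ ∑ v, P.x i v * I.prob i v (I.ρ i) :=
    sum_nonneg fun v _ => mul_nonneg (hP.x_nonneg i v) (I.prob_nonneg i v _)
  have hrepair : (0 : ℝ) < I.s i * P.xκ i := mul_pos (mod_cast I.s_pos i) hi
  rw [if_pos rfl] at hflow
  rw [PrimalVars.Charged]
  linarith

theorem charged_of_prob_pos (hP : I.PrimalFeasible P) {i : Fin n} {u v : S i}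
    (hu : 0 < P.x i u) (huv : 0 < I.prob i u v) : P.Charged i v := by
  have hflow := hP.sum_inflow_eq i v
  have hin : 0 < ∑ w, P.x i w * I.prob i w v :=
    sum_pos' (fun w _ => mul_nonneg (hP.x_nonneg i w) (I.prob_nonneg i w _))
      ⟨u, mem_univ u, mul_pos hu huv⟩
  have hrepair : (0 : ℝ) ≤ if v = I.ρ i then I.s i * P.xκ i else 0 := by
    split_ifs
    exacts [mul_nonneg (I.s i).2 (hP.xκ_nonneg i), le_rfl]
  rw [PrimalVars.Charged]
  linarith

theorem primalObjective_nonpos_of_one_le (hP : I.PrimalFeasible P) (hω : 1 ≤ P.ω) :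
    I.primalObjective P ≤ 0 := by
  refine sum_nonpos fun i _ => sum_nonpos fun u _ => ?_
  have hx : P.x i u = 0 := by
    have := single_le_sum (fun v _ => hP.x_nonneg i v) (mem_univ u)
    linarith [hP.mass i, hP.xκ_nonneg i, hP.x_nonneg i u]
  have := mul_nonneg (I.c_nonneg i u) (hP.z_nonneg i u)
  simpa [hx] using this

end PrimalFeasible

theorem exists_charged (hD : I.DualOptimal D) (hP : I.PrimalOptimal P) {i : Fin n}
    (hi : 0 < D.h i) : ∃ u, P.Charged i u := by
  have hω : P.ω < 1 := by
    by_contra! hω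
    have hobj := hP.1.primalObjective_nonpos_of_one_le hω
    rw [← dualObjective_eq_primalObjective hD hP, dualObjective, hD.1.balance] at hobj
    have := single_le_sum (fun j _ => hD.1.h_nonneg j) (mem_univ i)
    linarith
  rcases (hP.1.xκ_nonneg i).eq_or_lt with hκ | hκ
  · have hmass := (complementarySlack hD hP).mass i hi
    obtain ⟨u, -, hu⟩ := exists_lt_of_sum_lt
      (show ∑ _u : S i, (0 : ℝ) < ∑ u, P.x i u by rw [sum_const_zero]; linarith)
    exact ⟨u, add_pos_of_pos_of_nonneg hu (hP.1.z_nonneg i u)⟩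
  · exact ⟨I.ρ i, hP.1.charged_of_xκ_pos hκ⟩

theorem exists_goodStart (hD : I.DualOptimal D) (hP : I.PrimalOptimal P) :
    ∃ σ₀ : ∀ i, S i, I.GoodStart D P σ₀ := by
  have h (i) : ∃ u, 0 < D.h i → P.Charged i u := by
    by_cases hi : 0 < D.h i
    · exact (exists_charged hD hP hi).imp fun u hu _ => hu
    · exact ⟨I.ρ i, fun h => absurd h hi⟩
  choose σ₀ hσ₀ using h
  exact ⟨σ₀, fun i hi => Or.inl (hσ₀ i hi)⟩

end Charged

end Primal

end Model

/-! ### Drift of finite Markov chains -/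

section Drift

variable {α : Type*} {A : Set α}

theorem exists_rank_of_reachable {r : α → α → Prop}
    (hreach : ∀ u, ∃ w ∈ A, Relation.ReflTransGen r u w) :
    ∃ d : α → ℕ, (∀ u ∈ A, d u = 0) ∧ ∀ u ∉ A, ∃ v, r u v ∧ d v < d u := by
  classical
  have hiter (u) : ∃ m, u ∈ (fun X : Set α => {u | ∃ v ∈ X, r u v})^[m] A := by
    obtain ⟨w, hw, h⟩ := hreach u
    induction h using Relation.ReflTransGen.head_induction_on with
    | refl => exact ⟨0, hw⟩
    | head huv _ ih =>
      obtain ⟨m, hm⟩ := ih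
      exact ⟨m + 1, by rw [Function.iterate_succ_apply']; exact ⟨_, hm, huv⟩⟩
  refine ⟨fun u => Nat.find (hiter u), fun u hu => (Nat.find_eq_zero _).2 hu, fun u hu => ?_⟩
  obtain ⟨m, hm⟩ := Nat.exists_eq_succ_of_ne_zero (mt (Nat.find_eq_zero (hiter u)).1 hu)
  have hmem := Nat.find_spec (hiter u)
  rw [hm, Function.iterate_succ_apply'] at hmem
  obtain ⟨v, hv, huv⟩ := hmem
  exact ⟨v, huv, (Nat.lt_succ_of_le (Nat.find_min' (hiter v) hv)).trans_eq hm.symm⟩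

theorem exists_pos_lt_one_forall_lt {β : Type*} [Finite β] (f : β → ℝ) :
    ∃ ε : ℝ, 0 < ε ∧ ε < 1 ∧ ∀ b, 0 < f b → ε < f b := by
  obtain ⟨ε, hε, hlt⟩ := Pi.exists_forall_pos_add_lt (x := fun _ : Option β => (0 : ℝ))
    (y := fun o => o.elim 1 fun b => if 0 < f b then f b else 1) (by
      rintro (_ | b)
      · exact one_pos
      · dsimp only [Option.elim_some]
        split_ifs with h
        exacts [h, one_pos])
  simp only [zero_add] at hlt
  exact ⟨ε, hε, hlt none, fun b hb => by simpa [hb] using hlt (some b)⟩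

variable [Fintype α]

/-- The witness is a small number to the power of the distance to `A`: a step towards `A` gains
more than all other steps can lose. -/
theorem exists_drift_of_reachable {p : α → α → ℝ} (hp : ∀ u v, 0 ≤ p u v)
    (hsum : ∀ u, ∑ v, p u v = 1) (hA : ∀ u ∈ A, ∀ v, 0 < p u v → v ∈ A)
    (hreach : ∀ u, ∃ w ∈ A, Relation.ReflTransGen (fun a b => 0 < p a b) u w) :
    ∃ g : α → ℝ, (∀ u ∈ A, ∑ v, p u v * (g v - g u) = 0) ∧
      ∀ u ∉ A, 0 < ∑ v, p u v * (g v - g u) := by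
  obtain ⟨d, hd0, hd⟩ := exists_rank_of_reachable hreach
  obtain ⟨ε, hε0, hε1, hε⟩ := exists_pos_lt_one_forall_lt fun e : α × α => p e.1 e.2
  refine ⟨fun u => ε ^ d u, fun u hu => sum_eq_zero fun v _ => ?_, fun u hu => ?_⟩
  · rcases (hp u v).eq_or_lt with h | h
    · rw [← h, zero_mul]
    · simp only [hd0 u hu, hd0 v (hA u hu v h), sub_self, mul_zero]
  · simp only [mul_sub, sum_sub_distrib, ← sum_mul, hsum, one_mul, sub_pos]
    obtain ⟨v, hv, hdv⟩ := hd u hu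
    calc ε ^ d u ≤ ε ^ (d v + 1) := pow_le_pow_of_le_one hε0.le hε1.le hdv
      _ = ε * ε ^ d v := pow_succ' _ _
      _ < p u v * ε ^ d v := mul_lt_mul_of_pos_right (hε (u, v) hv) (pow_pos hε0 _)
      _ ≤ ∑ v, p u v * ε ^ d v :=
        single_le_sum (f := fun v => p u v * ε ^ d v)
          (fun v _ => mul_nonneg (hp u v) (pow_nonneg hε0.le _)) (mem_univ v)

end Drift

namespace Model

/-! ### Certificates -/

section Certificate

variable {n : ℕ} {S : Fin n → Type u} {I : Model n S} {D : DualVars S} {P : PrimalVars S}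

/-- Balanced policies move machine `i` to the repair queue when it is active in state `u`. -/
def ToRepair (D : DualVars S) (P : PrimalVars S) (i : Fin n) (u : S i) : Prop :=
  0 < D.h i ∧ 0 < P.z i u

/-- The potential `ψ` makes up for the repairs of machine `i`, and `G` contains the state in which
they end. -/
structure RepairPays (I : Model n S) (D : DualVars S) (i : Fin n) (ψ : S i → ℝ) (G : Set (S i)) :
    Prop where
  repair : D.lam + D.h i ≤ I.s i * ψ (I.ρ i)
  restart : I.ρ i ∈ G

variable [∀ i, Fintype (S i)]

/-- A potential `ψ` on the active states of machine `i` that certifies the rewards of a balanced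
policy, on a set `G` of states that such a policy does not leave. -/
structure Certificate (I : Model n S) (D : DualVars S) (P : PrimalVars S) (i : Fin n)
    (ψ : S i → ℝ) (G : Set (S i)) : Prop where
  stay : ∀ u ∈ G, ¬ ToRepair D P i u → D.h i ≤ I.r i u + ∑ v, I.prob i u v * (ψ v - ψ u)
  closed : ∀ u ∈ G, ¬ ToRepair D P i u → ∀ v, 0 < I.prob i u v → v ∈ G
  move : ∀ u ∈ G, ToRepair D P i u → ψ u ≤ -I.c i u
  repairPays : ∀ u ∈ G, ToRepair D P i u → I.RepairPays D i ψ G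

theorem certificate_of_h_eq_zero {i : Fin n} (hi : D.h i = 0) :
    I.Certificate D P i 0 Set.univ where
  stay u _ _ := by simpa [hi] using I.r_nonneg i u
  closed _ _ _ _ _ := trivial
  move _ _ h := absurd hi h.1.ne'
  repairPays _ _ h := absurd hi h.1.ne'

variable [∀ i, DecidableEq (S i)]

theorem certificate_of_charged (hP : I.PrimalFeasible P) (hcs : I.ComplementarySlack D P)
    {i : Fin n} (hi : 0 < D.h i) : I.Certificate D P i (D.phi i) {u | P.Charged i u} where
  stay u hu hz := (hcs.active i u (hP.x_pos_of_charged hu fun h => hz ⟨hi, h⟩)).le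
  closed u hu hz _ huv :=
    hP.charged_of_prob_pos (hP.x_pos_of_charged hu fun h => hz ⟨hi, h⟩) huv
  move u _ hz := by linarith [hcs.move i u hz.2]
  repairPays u _ hz :=
    have hκ := hP.xκ_pos_of_z_pos hz.2
    ⟨(hcs.repair i hκ).le, hP.charged_of_xκ_pos hκ⟩

/-- Every state leads to the support of `x`, so the dual inequalities can be mended outside of it
by adding a large multiple of a function with positive drift there and none on the support. -/
theorem exists_certificate_of_unichain (hP : I.PrimalFeasible P)
    (hcs : I.ComplementarySlack D P) {i : Fin n} (hρ : ¬ P.Charged i (I.ρ i))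
    (hex : ∃ u, P.Charged i u) (hI : I.Unichain i) :
    ∃ ψ : S i → ℝ, I.Certificate D P i ψ Set.univ := by
  have hz (u) : ¬ 0 < P.z i u := fun h => hρ (hP.charged_of_xκ_pos (hP.xκ_pos_of_z_pos h))
  have hclosed (u) (hu : 0 < P.x i u) (v) (huv : 0 < I.prob i u v) : 0 < P.x i v :=
    hP.x_pos_of_charged (hP.charged_of_prob_pos hu huv) (hz v)
  have hpath {u v} (hu : 0 < P.x i u)
      (huv : Relation.ReflTransGen (fun a b => 0 < I.prob i a b) u v) : 0 < P.x i v := by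
    induction huv with
    | refl => exact hu
    | tail _ hstep ih => exact hclosed _ ih _ hstep
  obtain ⟨u₀, hu₀⟩ := hex
  obtain ⟨w, hw⟩ := hI
  have hxw : 0 < P.x i w := hpath (hP.x_pos_of_charged hu₀ (hz u₀)) (hw u₀)
  obtain ⟨g, hg0, hg⟩ := exists_drift_of_reachable (A := {u | 0 < P.x i u}) (I.prob_nonneg i)
    (I.sum_prob i) hclosed fun u => ⟨w, hxw, hw u⟩
  let deficit (u : S i) : ℝ := D.h i - (I.r i u + ∑ v, I.prob i u v * (D.phi i v - D.phi i u))
  obtain ⟨K, hK⟩ := Finite.bddAbove_range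
    fun u => deficit u / ∑ v, I.prob i u v * (g v - g u)
  refine ⟨D.phi i + K • g, fun u _ _ => ?_, fun _ _ _ _ _ => trivial,
    fun u _ h => absurd h.2 (hz u), fun u _ h => absurd h.2 (hz u)⟩
  have hdrift : ∑ v, I.prob i u v * ((D.phi i + K • g) v - (D.phi i + K • g) u)
      = ∑ v, I.prob i u v * (D.phi i v - D.phi i u) + K * ∑ v, I.prob i u v * (g v - g u) := by
    simp only [mul_sum, ← sum_add_distrib, Pi.add_apply, Pi.smul_apply, smul_eq_mul]
    exact sum_congr rfl fun v _ => by ring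
  suffices deficit u ≤ K * ∑ v, I.prob i u v * (g v - g u) by linarith
  by_cases hu : 0 < P.x i u
  · rw [hg0 u hu, mul_zero]
    exact sub_nonpos.2 (hcs.active i u hu).le
  · exact (div_le_iff₀ (hg u hu)).1 (hK ⟨u, rfl⟩)

theorem exists_certificate (hD : I.DualOptimal D) (hP : I.PrimalOptimal P) {σ₀ : ∀ i, S i}
    (hσ₀ : I.GoodStart D P σ₀) (i : Fin n) :
    ∃ (ψ : S i → ℝ) (G : Set (S i)), I.Certificate D P i ψ G ∧ σ₀ i ∈ G := by
  have hcs := complementarySlack hD hP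
  rcases (hD.1.h_nonneg i).eq_or_lt with hi | hi
  · exact ⟨_, _, certificate_of_h_eq_zero hi.symm, trivial⟩
  by_cases hstart : P.Charged i (σ₀ i)
  · exact ⟨_, _, certificate_of_charged hP.1 hcs hi, hstart⟩
  obtain ⟨hρ, hI⟩ := (hσ₀ i hi).resolve_left hstart
  obtain ⟨ψ, hψ⟩ := exists_certificate_of_unichain hP.1 hcs (hρ ▸ hstart)
    (exists_charged hD hP hi) hI
  exact ⟨ψ, _, hψ, trivial⟩

end Certificate

end Model

/-! ### Expectations over finite types -/

/-- The expectation of a function under a distribution on a finite type. -/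
noncomputable def expect {α : Type*} [Fintype α] (μ : PMF α) (f : α → ℝ) : ℝ :=
  ∑ a, (μ a).toReal * f a

section Expect

variable {α β : Type*} [Fintype α] [Fintype β]

theorem expect_pure (a : α) (f : α → ℝ) : expect (PMF.pure a) f = f a := by
  classical
  rw [expect, Fintype.sum_eq_single a fun b hb => by simp [PMF.pure_apply, hb]]
  simp

theorem expect_bind (μ : PMF α) (κ : α → PMF β) (f : β → ℝ) :
    expect (μ.bind κ) f = expect μ fun a => expect (κ a) f := by
  have htoReal (b) : ((μ.bind κ) b).toReal = ∑ a, (μ a).toReal * (κ a b).toReal := by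
    rw [PMF.bind_apply, tsum_fintype, ENNReal.toReal_sum fun a _ =>
      ENNReal.mul_ne_top (μ.apply_ne_top a) ((κ a).apply_ne_top b)]
    simp only [ENNReal.toReal_mul]
  simp only [expect, htoReal, sum_mul, mul_sum, mul_assoc]
  exact sum_comm

theorem expect_map (μ : PMF α) (g : α → β) (f : β → ℝ) :
    expect (μ.map g) f = expect μ fun a => f (g a) := by
  simp only [← PMF.bind_pure_comp, expect_bind, Function.comp_apply, expect_pure]

theorem expect_const (μ : PMF α) (r : ℝ) : expect μ (fun _ => r) = r := by
  rw [expect, ← sum_mul, sum_toReal_pmf, one_mul]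

theorem expect_add (μ : PMF α) (f g : α → ℝ) :
    expect μ (fun a => f a + g a) = expect μ f + expect μ g := by
  simp only [expect, mul_add, sum_add_distrib]

theorem expect_sub (μ : PMF α) (f g : α → ℝ) :
    expect μ (fun a => f a - g a) = expect μ f - expect μ g := by
  simp only [expect, mul_sub, sum_sub_distrib]

theorem expect_sum {ι : Type*} (s : Finset ι) (μ : PMF α) (f : ι → α → ℝ) :
    expect μ (fun a => ∑ i ∈ s, f i a) = ∑ i ∈ s, expect μ (f i) := by
  simp only [expect, mul_sum]
  exact sum_comm

theorem expect_mono (μ : PMF α) {f g : α → ℝ} (h : ∀ a ∈ μ.support, f a ≤ g a) :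
    expect μ f ≤ expect μ g := by
  refine sum_le_sum fun a _ => ?_
  by_cases ha : a ∈ μ.support
  · exact mul_le_mul_of_nonneg_left (h a ha) ENNReal.toReal_nonneg
  · simp [(PMF.apply_eq_zero_iff μ a).2 ha]

theorem expect_le (μ : PMF α) {f : α → ℝ} {r : ℝ} (h : ∀ a ∈ μ.support, f a ≤ r) :
    expect μ f ≤ r :=
  (expect_mono μ h).trans_eq (expect_const μ r)

theorem le_expect (μ : PMF α) {f : α → ℝ} {r : ℝ} (h : ∀ a ∈ μ.support, r ≤ f a) :
    r ≤ expect μ f :=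
  (expect_const μ r).symm.trans_le (expect_mono μ h)

theorem expect_coin (s : ℝ≥0) (hs : s ≤ 1) (f : Bool → ℝ) :
    expect (coin s hs) f = s * f true + (1 - s) * f false := by
  have hfail : (1 - (s : ℝ≥0∞)).toReal = 1 - (s : ℝ) := by
    rw [ENNReal.toReal_sub_of_le (by exact_mod_cast hs) ENNReal.one_ne_top]
    simp
  simp [expect, coin, PMF.ofFintype_apply, hfail]

end Expect

section Independent

variable {n : ℕ} {A : Fin n → Type u} [∀ i, Fintype (A i)] (q : ∀ i, PMF (A i))

theorem mem_support_of_mem_support_independent {a : ∀ i, A i}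
    (ha : a ∈ (independent q).support) (i : Fin n) : a i ∈ (q i).support := by
  rw [independent, PMF.mem_support_ofFintype_iff] at ha
  exact prod_ne_zero_iff.1 ha i (mem_univ i)

theorem expect_independent_prod (f : ∀ i, A i → ℝ) :
    expect (independent q) (fun a => ∏ i, f i (a i)) = ∏ i, expect (q i) (f i) := by
  simp only [expect, independent, PMF.ofFintype_apply, ENNReal.toReal_prod, ← prod_mul_distrib,
    prod_univ_sum, Fintype.piFinset_univ]

theorem expect_independent_apply (i : Fin n) (f : A i → ℝ) :
    expect (independent q) (fun a => f (a i)) = expect (q i) f := by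
  classical
  let F : ∀ j, A j → ℝ := Function.update (fun _ _ => 1) i f
  have hF {j} (hj : j ≠ i) : F j = fun _ => 1 := Function.update_of_ne hj _ _
  have hFi : F i = f := Function.update_self _ _ _
  calc expect (independent q) (fun a => f (a i))
      = expect (independent q) (fun a => ∏ j, F j (a j)) := by
        congr 1 with a
        rw [Fintype.prod_eq_single i fun j hj => by rw [hF hj], hFi]
    _ = ∏ j, expect (q j) (F j) := expect_independent_prod q F
    _ = expect (q i) f := by
        rw [Fintype.prod_eq_single i fun j hj => by rw [hF hj, expect_const], hFi]

end Independent

namespace Model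

variable {n : ℕ} {S : Fin n → Type u}

/-! ### Rewards adjusted by a potential -/

section InQueue

variable {σ : Config S} {a : Decision n} {i : Fin n}

theorem InQueue.mem_move (hq : InQueue σ a i) {u : S i} (hu : σ i = .active u) : i ∈ a.move := by
  simpa [InQueue, hu] using hq

theorem exists_active_of_not_inQueue (hq : ¬ InQueue σ a i) : ∃ u, σ i = .active u := by
  rcases hσ : σ i with u | _ | _
  · exact ⟨u, rfl⟩
  · exact absurd (Or.inr (Or.inl hσ)) hq
  · exact absurd (Or.inr (Or.inr hσ)) hq

end InQueue

/-- The potential of a machine: given by a function on its active states, and zero in the repair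
queue. -/
def statusPotential {A : Type u} (ψ : A → ℝ) : Status A → ℝ
  | .active u => ψ u
  | .queued => 0
  | .inRepair => 0

/-- The total potential of all machines. -/
noncomputable def potential (ψ : ∀ i, S i → ℝ) (σ : Config S) : ℝ :=
  ∑ i, statusPotential (ψ i) (σ i)

section AdjustedReward

variable [∀ i, Fintype (S i)]

/-- The reward of machine `i` plus the expected increase of its potential. -/
noncomputable def machineAdjustedReward (I : Model n S) {i : Fin n} (ψ : S i → ℝ)
    (σ : Status (S i)) (a : Decision n) : ℝ :=
  I.machineReward a i σ + expect (I.machineStep a i σ) (statusPotential ψ) - statusPotential ψ σ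

/-- The reward plus the expected increase of the function `F` of the configuration. The increases
telescope, so this has the same long-run average as the reward. -/
noncomputable def adjustedReward (I : Model n S) (F : Config S → ℝ) (σ : Config S)
    (a : Decision n) : ℝ :=
  I.reward σ a + expect (I.step σ a) F - F σ

variable {I : Model n S} {σ : Config S} {a : Decision n} {i : Fin n}

theorem adjustedReward_potential (ψ : ∀ i, S i → ℝ) :
    I.adjustedReward (potential ψ) σ a = ∑ i, I.machineAdjustedReward (ψ i) (σ i) a := by
  have hstep : expect (I.step σ a) (potential ψ)
      = ∑ i, expect (I.machineStep a i (σ i)) (statusPotential (ψ i)) := by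
    unfold potential
    rw [expect_sum]
    exact sum_congr rfl fun i _ => expect_independent_apply _ i _
  simp only [adjustedReward, machineAdjustedReward, hstep, reward, potential, sum_add_distrib,
    sum_sub_distrib]

theorem machineAdjustedReward_of_mem_serve (ψ : S i → ℝ) (hi : i ∈ a.serve) (τ : Status (S i)) :
    I.machineAdjustedReward ψ τ a
      = I.machineReward a i τ - statusPotential ψ τ + I.s i * ψ (I.ρ i) := by
  unfold machineAdjustedReward machineStep
  rw [if_pos hi, expect_map, expect_coin]
  simp only [statusPotential, if_true, Bool.false_eq_true, if_false]
  ring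

theorem machineAdjustedReward_of_inQueue (ψ : S i → ℝ) (hi : i ∉ a.serve)
    (hq : InQueue σ a i) :
    I.machineAdjustedReward ψ (σ i) a = I.machineReward a i (σ i) - statusPotential ψ (σ i) := by
  unfold machineAdjustedReward machineStep
  rw [if_neg hi]
  rcases hσ : σ i with u | _ | _
  · simp only [if_pos (hq.mem_move hσ), expect_pure, statusPotential, add_zero]
  · simp only [expect_pure, statusPotential, add_zero]
  · simp only [expect_pure, statusPotential, add_zero]

theorem machineAdjustedReward_active (ψ : S i → ℝ) (hi : i ∉ a.serve) (hm : i ∉ a.move)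
    (u : S i) :
    I.machineAdjustedReward ψ (.active u) a = I.r i u + ∑ v, I.prob i u v * (ψ v - ψ u) := by
  unfold machineAdjustedReward machineStep
  simp only [machineReward, if_neg hi, if_neg hm, expect_map, statusPotential, sum_prob_mul_sub]
  exact add_sub_assoc _ _ _

end AdjustedReward

/-! ### The upper bound for feasible decisions -/

section Feasible

variable {I : Model n S} {D : DualVars S} {σ : Config S} {a : Decision n}

theorem machineReward_le_statusPotential {i : Fin n} {ψ : S i → ℝ} (hψ : ∀ u, 0 ≤ ψ u + I.c i u)
    (hq : InQueue σ a i) : I.machineReward a i (σ i) ≤ statusPotential ψ (σ i) := by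
  rcases hσ : σ i with u | _ | _
  · simp only [machineReward, if_pos (hq.mem_move hσ), statusPotential]
    linarith [hψ u]
  · exact le_rfl
  · exact le_rfl

variable [∀ i, Fintype (S i)]

theorem machineAdjustedReward_le (hD : I.DualFeasible D) (ha : I.Feasible σ a) (i : Fin n) :
    I.machineAdjustedReward (D.phi i) (σ i) a ≤ D.h i + if i ∈ a.serve then D.lam else 0 := by
  by_cases hs : i ∈ a.serve
  · rw [machineAdjustedReward_of_mem_serve _ hs, if_pos hs]
    linarith [machineReward_le_statusPotential (hD.move i) (ha.serve_inQueue i hs), hD.repair i]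
  rw [if_neg hs, add_zero]
  by_cases hq : InQueue σ a i
  · rw [machineAdjustedReward_of_inQueue _ hs hq]
    linarith [machineReward_le_statusPotential (hD.move i) hq, hD.h_nonneg i]
  · obtain ⟨u, hu⟩ := exists_active_of_not_inQueue hq
    rw [hu, machineAdjustedReward_active _ hs fun hm => hq (Or.inl hm)]
    exact hD.active i u

theorem adjustedReward_le_dualObjective (hD : I.DualFeasible D) (ha : I.Feasible σ a) :
    I.adjustedReward (potential D.phi) σ a ≤ I.dualObjective D := by
  have hcap : (a.serve.card : ℝ) ≤ I.M := by exact_mod_cast ha.capacity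
  calc I.adjustedReward (potential D.phi) σ a
      = ∑ i, I.machineAdjustedReward (D.phi i) (σ i) a := adjustedReward_potential _
    _ ≤ ∑ i, (D.h i + if i ∈ a.serve then D.lam else 0) :=
        sum_le_sum fun i _ => machineAdjustedReward_le hD ha i
    _ = a.serve.card * D.lam + ∑ i, D.h i := by simp [sum_add_distrib, add_comm]
    _ ≤ I.dualObjective D := by
        rw [dualObjective]
        gcongr
        exact hD.lam_nonneg

end Feasible

/-! ### The lower bound for balanced decisions -/

section Balanced

variable {I : Model n S} {D : DualVars S} {P : PrimalVars S} {σ : Config S} {a : Decision n}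
  {i : Fin n}

/-- The statuses of a machine that occur under a balanced policy, given its certificate. -/
def GoodStatus (I : Model n S) (D : DualVars S) (i : Fin n) (ψ : S i → ℝ) (G : Set (S i)) :
    Status (S i) → Prop
  | .active u => u ∈ G
  | .queued => I.RepairPays D i ψ G
  | .inRepair => I.RepairPays D i ψ G

theorem BalancedDecision.mem_move_iff_toRepair (ha : I.BalancedDecision D P σ a) {u : S i}
    (hu : σ i = .active u) : i ∈ a.move ↔ ToRepair D P i u := by
  simp [ha.move_iff i, hu, ToRepair]

theorem BalancedDecision.capacity_exhausted_or_all_served (ha : I.BalancedDecision D P σ a) :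
    a.serve.card = I.M ∨ ∀ i, InQueue σ a i → i ∈ a.serve := by
  have hsub : (a.serve : Set (Fin n)) ⊆ {i | InQueue σ a i} := ha.feasible.serve_inQueue
  rcases le_total I.M {i | InQueue σ a i}.ncard with hM | hM
  · exact Or.inl (ha.busy.trans (min_eq_left hM))
  · have hcard := ha.busy.trans (min_eq_right hM)
    have heq := Set.eq_of_subset_of_ncard_le hsub (by rw [Set.ncard_coe_finset, hcard])
    exact Or.inr fun i hi => mem_coe.1 (heq.symm.subset hi)

variable [∀ i, Fintype (S i)] {ψ : S i → ℝ} {G : Set (S i)}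

theorem BalancedDecision.repairPays (ha : I.BalancedDecision D P σ a)
    (hc : I.Certificate D P i ψ G) (hg : I.GoodStatus D i ψ G (σ i)) (hq : InQueue σ a i) :
    I.RepairPays D i ψ G := by
  rcases hσ : σ i with u | _ | _
  · rw [hσ] at hg
    exact hc.repairPays u hg ((ha.mem_move_iff_toRepair hσ).1 (hq.mem_move hσ))
  · rwa [hσ] at hg
  · rwa [hσ] at hg

theorem BalancedDecision.goodStatus_step (ha : I.BalancedDecision D P σ a)
    (hc : I.Certificate D P i ψ G) (hg : I.GoodStatus D i ψ G (σ i)) {τ : Status (S i)}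
    (hτ : τ ∈ (I.machineStep a i (σ i)).support) : I.GoodStatus D i ψ G τ := by
  unfold machineStep at hτ
  by_cases hs : i ∈ a.serve
  · rw [if_pos hs] at hτ
    have hpays := ha.repairPays hc hg (ha.feasible.serve_inQueue i hs)
    obtain ⟨_ | _, -, rfl⟩ := (PMF.mem_support_map_iff _ _ _).1 hτ
    · exact hpays
    · exact hpays.restart
  rw [if_neg hs] at hτ
  rcases hσ : σ i with u | _ | _ <;> simp only [hσ] at hg hτ
  · split_ifs at hτ with hm
    · obtain rfl := (PMF.mem_support_pure_iff _ _).1 hτ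
      exact ha.repairPays hc (hσ ▸ hg) (Or.inl hm)
    · obtain ⟨v, hv, rfl⟩ := (PMF.mem_support_map_iff _ _ _).1 hτ
      exact hc.closed u hg (fun h => hm ((ha.mem_move_iff_toRepair hσ).2 h)) v
        (ENNReal.toReal_pos hv ((I.p i u).apply_ne_top v))
  · obtain rfl := (PMF.mem_support_pure_iff _ _).1 hτ
    exact hg
  · obtain rfl := (PMF.mem_support_pure_iff _ _).1 hτ
    exact hg

theorem BalancedDecision.statusPotential_le_machineReward (ha : I.BalancedDecision D P σ a)
    (hc : I.Certificate D P i ψ G) (hg : I.GoodStatus D i ψ G (σ i)) (hq : InQueue σ a i) :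
    statusPotential ψ (σ i) ≤ I.machineReward a i (σ i) := by
  rcases hσ : σ i with u | _ | _
  · rw [hσ] at hg
    have hm := hq.mem_move hσ
    simp only [machineReward, if_pos hm, statusPotential]
    exact hc.move u hg ((ha.mem_move_iff_toRepair hσ).1 hm)
  · exact le_rfl
  · exact le_rfl

theorem BalancedDecision.le_machineAdjustedReward_of_mem_serve
    (ha : I.BalancedDecision D P σ a) (hc : I.Certificate D P i ψ G)
    (hg : I.GoodStatus D i ψ G (σ i)) (hs : i ∈ a.serve) :
    D.lam + D.h i ≤ I.machineAdjustedReward ψ (σ i) a := by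
  have hq := ha.feasible.serve_inQueue i hs
  rw [machineAdjustedReward_of_mem_serve ψ hs]
  linarith [ha.statusPotential_le_machineReward hc hg hq, (ha.repairPays hc hg hq).repair]

theorem BalancedDecision.machineAdjustedReward_nonneg_of_inQueue
    (ha : I.BalancedDecision D P σ a) (hc : I.Certificate D P i ψ G)
    (hg : I.GoodStatus D i ψ G (σ i)) (hs : i ∉ a.serve) (hq : InQueue σ a i) :
    0 ≤ I.machineAdjustedReward ψ (σ i) a := by
  rw [machineAdjustedReward_of_inQueue ψ hs hq]
  exact sub_nonneg.2 (ha.statusPotential_le_machineReward hc hg hq)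

theorem BalancedDecision.le_machineAdjustedReward_of_not_inQueue
    (ha : I.BalancedDecision D P σ a) (hc : I.Certificate D P i ψ G)
    (hg : I.GoodStatus D i ψ G (σ i)) (hq : ¬ InQueue σ a i) :
    D.h i ≤ I.machineAdjustedReward ψ (σ i) a := by
  obtain ⟨u, hu⟩ := exists_active_of_not_inQueue hq
  have hm : i ∉ a.move := fun h => hq (Or.inl h)
  rw [hu] at hg ⊢
  rw [machineAdjustedReward_active ψ (fun hs => hq (ha.feasible.serve_inQueue i hs)) hm]
  exact hc.stay u hg fun h => hm ((ha.mem_move_iff_toRepair hu).2 h)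

theorem BalancedDecision.le_adjustedReward (hD : I.DualFeasible D)
    (ha : I.BalancedDecision D P σ a) {ψ : ∀ i, S i → ℝ} {G : ∀ i, Set (S i)}
    (hc : ∀ i, I.Certificate D P i (ψ i) (G i))
    (hg : ∀ i, I.GoodStatus D i (ψ i) (G i) (σ i)) :
    I.M * D.lam ≤ I.adjustedReward (potential ψ) σ a := by
  have hserved (i) := ha.le_machineAdjustedReward_of_mem_serve (hc i) (hg i)
  have hrunning (i) := ha.le_machineAdjustedReward_of_not_inQueue (hc i) (hg i)
  rw [adjustedReward_potential]
  rcases ha.capacity_exhausted_or_all_served with hcard | hall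
  · calc I.M * D.lam = ∑ i, if i ∈ a.serve then D.lam else 0 := by simp [hcard]
      _ ≤ ∑ i, I.machineAdjustedReward (ψ i) (σ i) a := sum_le_sum fun i _ => by
          have hh := hD.h_nonneg i
          split_ifs with hs
          · linarith [hserved i hs]
          by_cases hq : InQueue σ a i
          · exact ha.machineAdjustedReward_nonneg_of_inQueue (hc i) (hg i) hs hq
          · exact hh.trans (hrunning i hq)
  · rw [hD.balance]
    refine sum_le_sum fun i _ => ?_
    by_cases hq : InQueue σ a i
    · linarith [hserved i (hall i hq), hD.lam_nonneg]
    · exact hrunning i hq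

end Balanced

end Model

/-! ### Long-run averages -/

/-- The history at the beginning of the first slot. -/
def History.start {n : ℕ} {S : Fin n → Type u} (σ : Config S) : History S 0 := σ

/-- The history after one more slot. -/
def History.extend {n : ℕ} {S : Fin n → Type u} {t : ℕ} (h : History S t) (a : Decision n)
    (σ : Config S) : History S (t + 1) := (h, a, σ)

theorem tendsto_add_div_atTop (v C : ℝ) :
    Tendsto (fun T : ℕ => ((v + C / T : ℝ) : EReal)) atTop (nhds (v : EReal)) := by
  have h := (tendsto_const_div_atTop_nhds_zero_nat C).const_add v
  rw [add_zero] at h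
  exact (continuous_coe_real_ereal.tendsto v).comp h

namespace Model

variable {n : ℕ} {S : Fin n → Type u} {I : Model n S}

section Average

variable [∀ i, Fintype (S i)] {σ₀ : ∀ i, S i} {π : Policy S}

theorem law_zero : I.law σ₀ π 0 = PMF.pure (History.start fun i => .active (σ₀ i)) := rfl

theorem law_succ (t : ℕ) : I.law σ₀ π (t + 1) = (I.law σ₀ π t).bind fun h =>
    (π t h).bind fun a => (I.step h.current a).map (h.extend a) := rfl

theorem law_invariant (Q : Config S → Prop) (h0 : Q fun i => .active (σ₀ i))
    (hstep : ∀ t, ∀ h ∈ (I.law σ₀ π t).support, ∀ a ∈ (π t h).support, Q h.current →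
      ∀ τ ∈ (I.step h.current a).support, Q τ) :
    ∀ t, ∀ h ∈ (I.law σ₀ π t).support, Q h.current
  | 0, h, hh => by
    rw [law_zero, PMF.mem_support_pure_iff] at hh
    exact hh ▸ h0
  | t + 1, h, hh => by
    simp only [law_succ, PMF.mem_support_bind_iff, PMF.mem_support_map_iff] at hh
    obtain ⟨h', hh', a, ha, τ, hτ, rfl⟩ := hh
    exact hstep t h' hh' a ha (law_invariant Q h0 hstep t h' hh') τ hτ

theorem expectedReward_eq (F : Config S → ℝ) (t : ℕ) :
    I.expectedReward σ₀ π t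
      = expect (I.law σ₀ π t) (fun h => expect (π t h) (I.adjustedReward F h.current))
        - (expect (I.law σ₀ π (t + 1)) (fun h => F h.current)
          - expect (I.law σ₀ π t) fun h => F h.current) := by
  have hnext : expect (I.law σ₀ π (t + 1)) (fun h => F h.current)
      = expect (I.law σ₀ π t) fun h => expect (π t h) fun a =>
        expect (I.step h.current a) F := by
    simp only [law_succ, expect_bind, expect_map]
    rfl
  have hreward : I.expectedReward σ₀ π t
      = expect (I.law σ₀ π t) fun h => expect (π t h) fun a => I.reward h.current a := rfl
  unfold adjustedReward
  simp only [hnext, hreward, expect_add, expect_sub, expect_const]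
  ring

theorem sum_expectedReward_eq (F : Config S → ℝ) (T : ℕ) :
    ∑ t ∈ range T, I.expectedReward σ₀ π t
      = ∑ t ∈ range T,
          expect (I.law σ₀ π t) (fun h => expect (π t h) (I.adjustedReward F h.current))
        - (expect (I.law σ₀ π T) (fun h => F h.current)
          - expect (I.law σ₀ π 0) fun h => F h.current) := by
  rw [← sum_range_sub fun t => expect (I.law σ₀ π t) fun h => F h.current, ← sum_sub_distrib]
  exact sum_congr rfl fun t _ => expectedReward_eq F t

theorem exists_abs_expect_law_le (F : Config S → ℝ) :
    ∃ B, ∀ T, |expect (I.law σ₀ π T) fun h => F h.current| ≤ B := by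
  obtain ⟨B, hB⟩ := Finite.bddAbove_range fun σ => |F σ|
  have hB' (σ) : |F σ| ≤ B := hB ⟨σ, rfl⟩
  exact ⟨B, fun T => abs_le.2 ⟨le_expect _ fun h _ => (abs_le.1 (hB' _)).1,
    expect_le _ fun h _ => (abs_le.1 (hB' _)).2⟩⟩

theorem exists_abs_sum_expectedReward_sub_le (F : Config S → ℝ) :
    ∃ B, ∀ T, |∑ t ∈ range T, I.expectedReward σ₀ π t - ∑ t ∈ range T,
      expect (I.law σ₀ π t) fun h => expect (π t h) (I.adjustedReward F h.current)| ≤ B := by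
  obtain ⟨B, hB⟩ := exists_abs_expect_law_le (I := I) (σ₀ := σ₀) (π := π) F
  refine ⟨B + B, fun T => ?_⟩
  rw [sum_expectedReward_eq F, sub_right_comm, sub_self, zero_sub, abs_neg]
  exact (abs_sub _ _).trans (add_le_add (hB T) (hB 0))

variable {F : Config S → ℝ} {v : ℝ}

theorem limsup_average_le
    (hF : ∀ t, ∀ h ∈ (I.law σ₀ π t).support, ∀ a ∈ (π t h).support,
      I.adjustedReward F h.current a ≤ v) :
    limsup (fun T => (I.average σ₀ π T : EReal)) atTop ≤ v := by
  obtain ⟨B, hB⟩ := exists_abs_sum_expectedReward_sub_le (I := I) (σ₀ := σ₀) (π := π) F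
  rw [← (tendsto_add_div_atTop v B).limsup_eq]
  refine limsup_le_limsup ?_
  filter_upwards [eventually_gt_atTop 0] with T hT
  have hT' : (0 : ℝ) < T := by exact_mod_cast hT
  rw [EReal.coe_le_coe_iff, average, div_le_iff₀ hT', add_mul, div_mul_cancel₀ _ hT'.ne']
  have hsum := sum_le_card_nsmul (range T) _ v fun t _ =>
    expect_le (I.law σ₀ π t) fun h hh => expect_le (π t h) fun a ha => hF t h hh a ha
  rw [card_range, nsmul_eq_mul] at hsum
  linarith [(abs_le.1 (hB T)).2]

theorem le_liminf_average
    (hF : ∀ t, ∀ h ∈ (I.law σ₀ π t).support, ∀ a ∈ (π t h).support,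
      v ≤ I.adjustedReward F h.current a) :
    v ≤ liminf (fun T => (I.average σ₀ π T : EReal)) atTop := by
  obtain ⟨B, hB⟩ := exists_abs_sum_expectedReward_sub_le (I := I) (σ₀ := σ₀) (π := π) F
  rw [← (tendsto_add_div_atTop v (-B)).liminf_eq]
  refine liminf_le_liminf ?_
  filter_upwards [eventually_gt_atTop 0] with T hT
  have hT' : (0 : ℝ) < T := by exact_mod_cast hT
  rw [EReal.coe_le_coe_iff, average, le_div_iff₀ hT', add_mul, div_mul_cancel₀ _ hT'.ne']
  have hsum := card_nsmul_le_sum (range T) _ v fun t _ =>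
    le_expect (I.law σ₀ π t) fun h hh => le_expect (π t h) fun a ha => hF t h hh a ha
  rw [card_range, nsmul_eq_mul] at hsum
  linarith [(abs_le.1 (hB T)).1]

theorem optimalValue_le {D : DualVars S} (hD : I.DualFeasible D) :
    I.optimalValue ≤ I.dualObjective D :=
  iSup_le fun _ => iSup_le fun _ => iSup_le fun hπ => limsup_average_le fun t h hh a ha =>
    adjustedReward_le_dualObjective hD (hπ t h hh a ha)

end Average

/-! ### Balanced policies -/

section BalancedPolicy

theorem exists_balancedDecision (D : DualVars S) (P : PrimalVars S) {σ : Config S}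
    (hσ : {i | σ i = .inRepair}.ncard ≤ I.M) : ∃ a, I.BalancedDecision D P σ a := by
  classical
  let move : Finset (Fin n) := {i | 0 < D.h i ∧ ∃ u, σ i = .active u ∧ 0 < P.z i u}
  let started : Finset (Fin n) := {i | σ i = .inRepair}
  let queue : Finset (Fin n) := {i | i ∈ move ∨ σ i = .queued ∨ σ i = .inRepair}
  have hmove (i) : i ∈ move ↔ 0 < D.h i ∧ ∃ u, σ i = .active u ∧ 0 < P.z i u := by simp [move]
  have hqueue (serve) : {i | InQueue σ (move, serve) i} = queue := by
    ext i
    simp [InQueue, queue]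
  have hstarted : started.card ≤ I.M := by
    rwa [← Set.ncard_coe_finset, coe_filter_univ]
  have hsub : started ⊆ queue := monotone_filter_right _ fun i _ hi => Or.inr (Or.inr hi)
  obtain ⟨serve, hstart, hserve, hcard⟩ := exists_subsuperset_card_eq hsub
    (le_min hstarted (card_le_card hsub)) (min_le_right I.M queue.card)
  refine ⟨(move, serve), ⟨fun i hi => ?_, fun i hi => ?_, fun i hi => ?_, ?_⟩, hmove, ?_⟩
  · exact ((hmove i).1 hi).2.imp fun u hu => hu.1
  · exact (hqueue serve).superset (hserve hi)
  · exact hstart (mem_filter.2 ⟨mem_univ i, hi⟩)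
  · exact hcard.trans_le (min_le_left _ _)
  · rw [hqueue, Set.ncard_coe_finset]
    exact hcard

theorem mem_serve_of_inRepair_mem_support {σ : Config S} {a : Decision n} (ha : I.Feasible σ a)
    {i : Fin n} (hi : .inRepair ∈ (I.machineStep a i (σ i)).support) : i ∈ a.serve := by
  by_contra hs
  unfold machineStep at hi
  rw [if_neg hs] at hi
  rcases hσ : σ i with u | _ | _
  · by_cases hm : i ∈ a.move <;> simp [hσ, hm] at hi
  · simp [hσ] at hi
  · exact hs (ha.nonpreemptive i hσ)

variable [∀ i, Fintype (S i)] {σ₀ : ∀ i, S i} {π : Policy S}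

theorem ncard_inRepair_le_of_mem_support_step {σ τ : Config S} {a : Decision n}
    (ha : I.Feasible σ a) (hτ : τ ∈ (I.step σ a).support) :
    {i | τ i = .inRepair}.ncard ≤ I.M := by
  have hsub : {i | τ i = .inRepair} ⊆ (a.serve : Set (Fin n)) := fun i hi =>
    mem_serve_of_inRepair_mem_support ha (hi ▸ mem_support_of_mem_support_independent _ hτ i)
  calc {i | τ i = .inRepair}.ncard
      ≤ (a.serve : Set (Fin n)).ncard := Set.ncard_le_ncard hsub
    _ = a.serve.card := Set.ncard_coe_finset _
    _ ≤ I.M := ha.capacity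

variable (I σ₀) in
theorem exists_isBalancedPolicy (D : DualVars S) (P : PrimalVars S) :
    ∃ π : Policy S, I.IsBalancedPolicy D P σ₀ π := by
  have hdec (σ : Config S) : ∃ a, {i | σ i = .inRepair}.ncard ≤ I.M →
      I.BalancedDecision D P σ a := by
    by_cases hσ : {i | σ i = .inRepair}.ncard ≤ I.M
    · exact (exists_balancedDecision D P hσ).imp fun a ha _ => ha
    · exact ⟨(∅, ∅), fun h => absurd h hσ⟩
  choose dec hdec using hdec
  let π : Policy S := fun _ h => PMF.pure (dec h.current)
  have hπ {t} {h : History S t} {a} (ha : a ∈ (π t h).support) : a = dec h.current :=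
    (PMF.mem_support_pure_iff _ _).1 ha
  have hinv := law_invariant (I := I) (σ₀ := σ₀) (π := π)
    (fun σ => {i | σ i = .inRepair}.ncard ≤ I.M) (by simp) fun t h _ a ha hQ τ hτ =>
      ncard_inRepair_le_of_mem_support_step (hdec _ hQ).feasible (hπ ha ▸ hτ)
  exact ⟨π, fun t h hh a ha => hπ ha ▸ hdec _ (hinv t h hh)⟩

theorem IsBalancedPolicy.admissible {D : DualVars S} {P : PrimalVars S}
    (hπ : I.IsBalancedPolicy D P σ₀ π) : I.Admissible σ₀ π :=
  fun t h hh a ha => (hπ t h hh a ha).feasible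

theorem IsBalancedPolicy.le_guaranteedValue [∀ i, DecidableEq (S i)] {D : DualVars S}
    {P : PrimalVars S} (hD : I.DualOptimal D) (hP : I.PrimalOptimal P)
    (hσ₀ : I.GoodStart D P σ₀) (hπ : I.IsBalancedPolicy D P σ₀ π) :
    ((I.M * D.lam : ℝ) : EReal) ≤ I.guaranteedValue σ₀ π := by
  choose ψ G hc hG using exists_certificate hD hP hσ₀
  have hgood := law_invariant (I := I) (σ₀ := σ₀) (π := π)
    (fun σ => ∀ i, I.GoodStatus D i (ψ i) (G i) (σ i)) hG
    fun t h hh a ha hg τ hτ i => (hπ t h hh a ha).goodStatus_step (hc i) (hg i)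
      (mem_support_of_mem_support_independent _ hτ i)
  exact le_liminf_average fun t h hh a ha =>
    (hπ t h hh a ha).le_adjustedReward hD.1 hc (hgood t h hh)

end BalancedPolicy

end Model

end Replenishment

theorem mainTheorem4 {n : ℕ} {S : Fin n → Type u} [∀ i, Fintype (S i)]
    [∀ i, DecidableEq (S i)] (I : Replenishment.Model n S) :
    (∃ (D : Replenishment.DualVars S) (P : Replenishment.PrimalVars S),
      I.DualOptimal D ∧ I.PrimalOptimal P) ∧
    ∀ (D : Replenishment.DualVars S) (P : Replenishment.PrimalVars S),
      I.DualOptimal D → I.PrimalOptimal P →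
      (∃ σ₀ : ∀ i, S i, I.GoodStart D P σ₀) ∧
      ∀ σ₀ : ∀ i, S i, I.GoodStart D P σ₀ →
        (∃ π : Replenishment.Policy S, I.IsBalancedPolicy D P σ₀ π) ∧
        ∀ π : Replenishment.Policy S, I.IsBalancedPolicy D P σ₀ π →
          I.Admissible σ₀ π ∧ I.optimalValue ≤ 2 * I.guaranteedValue σ₀ π := by
  obtain ⟨D₀, P₀, hD₀, hP₀, -⟩ := I.exists_optimal_pair
  refine ⟨⟨D₀, P₀, hD₀, hP₀⟩, fun D P hD hP => ⟨Replenishment.Model.exists_goodStart hD hP,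
    fun σ₀ hσ₀ => ⟨I.exists_isBalancedPolicy σ₀ D P, fun π hπ => ⟨hπ.admissible, ?_⟩⟩⟩⟩
  calc I.optimalValue ≤ I.dualObjective D := Replenishment.Model.optimalValue_le hD.1
    _ = 2 * ((I.M * D.lam : ℝ) : EReal) := by rw [hD.1.dualObjective_eq, EReal.coe_mul]; rfl
    _ ≤ 2 * I.guaranteedValue σ₀ π :=
      mul_le_mul_of_nonneg_left (hπ.le_guaranteedValue hD hP hσ₀) zero_le_two
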